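/- **Setting.** Let $K\ge 1$, let $\nu=(\nu_1,\dots,\nu_K)$ be probability distributions on $\mathbb R$ supported in $[0,1]$ with means $\mu_1,\dots,\mu_K$, and put $\mu^*=\max_a\mu_a$, $\Delta_a=\mu^*-\mu_a$. In round $t$ an algorithm plays an arm $A_t$ and receives a reward $R_t$ which, conditionally on the past (including the internal randomness of the algorithm used so far) and on $A_t$, has law $\nu_{A_t}$. Let $N_a(t)=\#\{s\le t: A_s=a\}$ and $\mathrm{Reg}_T=T\mu^*-\mathbb E\big[\sum_{t=1}^T R_t\big]$. Let $\mathrm{Lap}(b)$ be the centred Laplace distribution with scale $b$ (density $\frac1{2b}e^{-|x|/b}$). **AdaP-UCB** with parameters $\alpha>3$ and $\epsilon>0$. Rounds $1,\dots,K$ play each arm once (each of these rounds is an episode of length one). Afterwards the algorithm proceeds in episodes: the episode starting in round $t_\ell$ plays an arm $A\in\operatorname{argmax}_a I_a$ (ties broken arbitrarily) until round $t$ with $N_{A}(t)=2N_{A}(t_\ell-1)$, where $$I_a=\tilde\mu_a+\sqrt{\frac{\alpha\log t_\ell}{2\cdot\frac12N_a(t_\ell-1)}}+\frac{\alpha\log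 t_\ell}{\epsilon\cdot\frac12N_a(t_\ell-1)}$$ and $\tilde\mu_a$ is the private mean of arm $a$, computed once, at the end of the last completed episode in which $a$ was played: the average of the rewards of that episode plus independent noise of law $\mathrm{Lap}\big(\frac{2}{\epsilon N_a(t_\ell-1)}\big)$. **Theorem.** Let $\alpha>3$. (i) For all $K\ge1$, $\epsilon>0$, all $\nu$ as above and every horizon $T\in\mathbb N$ (with $\log 0:=0$), AdaP-UCB satisfies $$\mathrm{Reg}_T\le B_T(\nu):=\frac{3\alpha}{\alpha-3}\sum_{a=1}^K\Delta_a+8\sqrt{\alpha KT\log T}+\frac{16\,\alpha K\log T}{\epsilon}.$$ (ii) This bound is, up to a factor of order $\log T$, the minimax lower bound for $\epsilon$-globally differentially private bandits, $\max\big\{\frac1{27}\sqrt{T(K-1)},\ \frac1{131}\frac{K-1}{\epsilon}\big\}$: there is a constant $C>0$ depending only on $\alpha$ such that for all $K\ge2$, $\epsilon>0$, $T\ge\max\{2,K-1\}$ and all $\nu$ as above, $$B_T(\nu)\le C\,\log T\cdot\max\Big\{\frac1{27}\sqrt{T(K-1)},\ \frac1{131}\frac{K-1}{\epsilon}\Big\}.$$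 -/

import Mathlib

noncomputable section

open MeasureTheory ProbabilityTheory

namespace AdaP

/-! ### The Laplace distribution -/

/-- Density of the centred Laplace distribution with scale `b` (variance `2 * b ^ 2`). -/
def laplacePDF (b x : ℝ) : ℝ := 1 / (2 * b) * Real.exp (-(|x| / b))

/-- The Laplace distribution `Lap(b)`. For a scale `b ≤ 0`, which never occurs below, it is set to
the point mass at `0`. -/
def laplace (b : ℝ) : Measure ℝ :=
  if 0 < b then volume.withDensity (fun x => ENNReal.ofReal (laplacePDF b x))
  else Measure.dirac 0

theorem integral_laplacePDF {b : ℝ} (hb : 0 < b) : ∫ x, laplacePDF b x = 1 := by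
  have h1 : ∫ x : ℝ, Real.exp (-|x|) = 2 := by
    have := integral_comp_abs (f := fun x : ℝ => Real.exp (-x))
    rw [this, integral_exp_neg_Ioi_zero, mul_one]
  have h2 := Measure.integral_comp_div (fun x : ℝ => Real.exp (-|x|)) b
  simp only [abs_div, abs_of_pos hb, h1, smul_eq_mul] at h2
  unfold laplacePDF
  rw [integral_const_mul, h2]
  field_simp

instance (b : ℝ) : IsProbabilityMeasure (laplace b) := by
  unfold laplace
  split_ifs with hb
  · refine ⟨?_⟩
    have hi : Integrable (laplacePDF b) := by
      refine Integrable.of_integral_ne_zero ?_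
      rw [integral_laplacePDF hb]
      exact one_ne_zero
    rw [withDensity_apply _ MeasurableSet.univ, Measure.restrict_univ,
      ← ofReal_integral_eq_lintegral_ofReal hi, integral_laplacePDF hb, ENNReal.ofReal_one]
    refine Filter.Eventually.of_forall fun x => ?_
    simp only [laplacePDF, Pi.zero_apply]
    positivity
  · infer_instance

/-! ### The algorithm

Arms are the elements of `Fin K`. Below, `n` is the number of completed rounds, so the round about
to be played is round `t = n + 1`. -/

/-- A choice of `argmax`, i.e. a rule selecting a maximiser of a vector of indexes, with arbitrary
(measurable) tie breaking. -/
structure ArgmaxRule (K : ℕ) where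
  select : (Fin K → ℝ) → Fin K
  measurable_select : Measurable select
  le_select : ∀ (v : Fin K → ℝ) (a : Fin K), v a ≤ v (select v)

/-- Ties can be broken in favour of the first arm. -/
instance (K : ℕ) [NeZero K] : Nonempty (ArgmaxRule K) := by
  classical
  have hne : ∀ v : Fin K → ℝ, (Finset.univ.filter fun a => ∀ b, v b ≤ v a).Nonempty := by
    intro v
    obtain ⟨a, ha⟩ := Finite.exists_max v
    exact ⟨a, by simpa using ha⟩
  refine ⟨⟨fun v => (Finset.univ.filter fun a => ∀ b, v b ≤ v a).min' (hne v), ?_, ?_⟩⟩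
  · refine measurable_to_countable' fun a => ?_
    have : (fun v : Fin K → ℝ => (Finset.univ.filter fun a => ∀ b, v b ≤ v a).min' (hne v)) ⁻¹' {a}
        = {v | (∀ b, v b ≤ v a) ∧ ∀ c, (∀ b, v b ≤ v c) → a ≤ c} := by
      ext v
      simp [Finset.min'_eq_iff]
    rw [this]
    measurability
  · intro v
    have := Finset.min'_mem _ (hne v)
    simpa using this

/-- The memory of the algorithm between rounds. -/
structure State (K : ℕ) where
  /-- `N_a(t)`: the number of times that arm `a` has been played. -/
  count : Fin K → ℕ
  /-- The private empirical mean released at the end of the last active episode of each arm. -/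
  privMean : Fin K → ℝ
  /-- The arm played in the current episode. -/
  arm : Fin K
  /-- The number of plays of `arm` before the current episode. -/
  start : ℕ
  /-- The current episode lasts until `arm` has been played `goal` times. -/
  goal : ℕ
  /-- The sum of the rewards collected so far in the current episode. -/
  rewardSum : ℝ

variable {K : ℕ}

/-- The index `I_a^ε(t - 1, α)` of arm `a` at the start `t` of an episode. -/
def index (α ε : ℝ) (t : ℕ) (s : State K) (a : Fin K) : ℝ :=
  s.privMean a
    + Real.sqrt (α * Real.log t / (2 * (1 / 2 * (s.count a : ℝ))))
    + α * Real.log t / (ε * (1 / 2 * (s.count a : ℝ)))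

/-- The state of the algorithm before the first round. -/
def initState (K : ℕ) [NeZero K] : State K where
  count := fun _ => 0
  privMean := fun _ => 0
  arm := 0
  start := 0
  goal := 0
  rewardSum := 0

/-- What the algorithm does at the beginning of round `n + 1`. In the first `K` rounds each arm is
played once (an episode of length one). Afterwards the current episode goes on if it is not
finished; otherwise a new episode starts, with an arm of largest index, that lasts until the number
of plays of this arm has doubled. -/
def beginRound (σ : ArgmaxRule K) (α ε : ℝ) (n : ℕ) (s : State K) : State K :=
  if h : n < K then
    { s with arm := ⟨n, h⟩, start := 0, goal := 1, rewardSum := 0 }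
  else if s.count s.arm < s.goal then s
  else
    { s with
      arm := σ.select (index α ε (n + 1) s)
      start := s.count (σ.select (index α ε (n + 1) s))
      goal := 2 * s.count (σ.select (index α ε (n + 1) s))
      rewardSum := 0 }

/-- What the algorithm does at the end of a round with reward `r`. If this round ends the episode,
the mean of the rewards of this episode plus the noise `z` becomes the private mean of the arm. -/
def endRound (s : State K) (r z : ℝ) : State K :=
  { s with
    count := Function.update s.count s.arm (s.count s.arm + 1)
    rewardSum := s.rewardSum + r
    privMean :=
      if s.count s.arm + 1 = s.goal then
        Function.update s.privMean s.arm
          ((s.rewardSum + r) / ((s.goal : ℝ) - (s.start : ℝ)) + z)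
      else s.privMean }

/-- The record of one round: the arm played, the reward, and the privacy noise of the algorithm. -/
abbrev Round (K : ℕ) : Type := Fin K × ℝ × ℝ

/-- The state of the algorithm after the `n` rounds recorded in `h`. -/
def state [NeZero K] (σ : ArgmaxRule K) (α ε : ℝ) : (n : ℕ) → (Fin n → Round K) → State K
  | 0, _ => initState K
  | n + 1, h =>
      endRound (beginRound σ α ε n (state σ α ε n (Fin.init h)))
        (h (Fin.last n)).2.1 (h (Fin.last n)).2.2

/-- The arm played in round `n + 1`. -/
def nextArm [NeZero K] (σ : ArgmaxRule K) (α ε : ℝ) (n : ℕ) (h : Fin n → Round K) : Fin K :=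
  (beginRound σ α ε n (state σ α ε n h)).arm

/-- The number of plays, round `n + 1` included, of the arm played in round `n + 1`. -/
def nextCount [NeZero K] (σ : ArgmaxRule K) (α ε : ℝ) (n : ℕ) (h : Fin n → Round K) : ℕ :=
  (state σ α ε n h).count (nextArm σ α ε n h) + 1

/-! ### Measurability of the algorithm -/

/-- A state that depends measurably on a parameter, field by field. -/
structure MeasState {Ω : Type*} [MeasurableSpace Ω] (f : Ω → State K) : Prop where
  count : Measurable fun ω => (f ω).count
  privMean : Measurable fun ω => (f ω).privMean
  arm : Measurable fun ω => (f ω).arm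
  start : Measurable fun ω => (f ω).start
  goal : Measurable fun ω => (f ω).goal
  rewardSum : Measurable fun ω => (f ω).rewardSum

theorem measurable_apply_arm {Ω β : Type*} [MeasurableSpace Ω] [MeasurableSpace β]
    {f : Ω → Fin K → β} {g : Ω → Fin K} (hf : Measurable f) (hg : Measurable g) :
    Measurable fun ω => f ω (g ω) := by
  have : Measurable fun p : Fin K × Ω => f p.2 p.1 :=
    measurable_from_prod_countable_right fun a => (measurable_pi_apply a).comp hf
  exact this.comp (hg.prodMk measurable_id)

theorem measurable_update_arm {Ω β : Type*} [MeasurableSpace Ω] [MeasurableSpace β]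
    {f : Ω → Fin K → β} {g : Ω → Fin K} {x : Ω → β}
    (hf : Measurable f) (hg : Measurable g) (hx : Measurable x) :
    Measurable fun ω => Function.update (f ω) (g ω) (x ω) := by
  rw [measurable_pi_iff]
  intro a
  simp only [Function.update_apply]
  exact Measurable.ite (hg (measurableSet_singleton a) |>.congr (by ext; simp [eq_comm]))
    hx ((measurable_pi_apply a).comp hf)

theorem MeasState.measurable_index {Ω : Type*} [MeasurableSpace Ω] {f : Ω → State K}
    (hf : MeasState f) (α ε : ℝ) (t : ℕ) : Measurable fun ω => index α ε t (f ω) := by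
  rw [measurable_pi_iff]
  intro a
  have h1 : Measurable fun ω => (f ω).privMean a := (measurable_pi_apply a).comp hf.privMean
  have h2 : Measurable fun ω => ((f ω).count a : ℝ) :=
    measurable_from_nat.comp ((measurable_pi_apply a).comp hf.count)
  unfold index
  fun_prop

theorem MeasState.beginRound {Ω : Type*} [MeasurableSpace Ω] {f : Ω → State K}
    (hf : MeasState f) (σ : ArgmaxRule K) (α ε : ℝ) (n : ℕ) :
    MeasState fun ω => beginRound σ α ε n (f ω) := by
  by_cases h : n < K
  · simp only [AdaP.beginRound, h, dite_true]
    exact ⟨hf.count, hf.privMean, measurable_const, measurable_const, measurable_const,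
      measurable_const⟩
  · have hs : Measurable fun ω => σ.select (index α ε (n + 1) (f ω)) :=
      σ.measurable_select.comp (hf.measurable_index α ε (n + 1))
    have hc := measurable_apply_arm hf.count hs
    have hE : MeasurableSet {ω | (f ω).count (f ω).arm < (f ω).goal} :=
      measurableSet_lt (measurable_apply_arm hf.count hf.arm) hf.goal
    simp only [AdaP.beginRound, h, dite_false]
    refine ⟨?_, ?_, ?_, ?_, ?_, ?_⟩ <;> simp only [apply_ite State.count,
      apply_ite State.privMean, apply_ite State.arm, apply_ite State.start, apply_ite State.goal,
      apply_ite State.rewardSum]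
    · exact Measurable.ite hE hf.count hf.count
    · exact Measurable.ite hE hf.privMean hf.privMean
    · exact Measurable.ite hE hf.arm hs
    · exact Measurable.ite hE hf.start hc
    · exact Measurable.ite hE hf.goal (hc.const_mul 2)
    · exact Measurable.ite hE hf.rewardSum measurable_const

theorem MeasState.endRound {Ω : Type*} [MeasurableSpace Ω] {f : Ω → State K} {r z : Ω → ℝ}
    (hf : MeasState f) (hr : Measurable r) (hz : Measurable z) :
    MeasState fun ω => endRound (f ω) (r ω) (z ω) := by
  have hc := measurable_apply_arm hf.count hf.arm
  have hg : Measurable fun ω => ((f ω).goal : ℝ) := measurable_from_nat.comp hf.goal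
  have hs : Measurable fun ω => ((f ω).start : ℝ) := measurable_from_nat.comp hf.start
  refine ⟨?_, ?_, hf.arm, hf.start, hf.goal, hf.rewardSum.add hr⟩
  · exact measurable_update_arm hf.count hf.arm (hc.add_const 1)
  · exact Measurable.ite (measurableSet_eq_fun (hc.add_const 1) hf.goal)
      (measurable_update_arm hf.privMean hf.arm
        (((hf.rewardSum.add hr).div (hg.sub hs)).add hz)) hf.privMean

theorem measState_state [NeZero K] (σ : ArgmaxRule K) (α ε : ℝ) (n : ℕ) :
    MeasState (state σ α ε n) := by
  induction n with
  | zero =>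
    exact ⟨measurable_const, measurable_const, measurable_const, measurable_const,
      measurable_const, measurable_const⟩
  | succ n ih =>
    have hi : Measurable fun h : Fin (n + 1) → Round K => (Fin.init h : Fin n → Round K) :=
      measurable_pi_iff.2 fun i => measurable_pi_apply i.castSucc
    have ih' : MeasState fun h : Fin (n + 1) → Round K => state σ α ε n (Fin.init h) :=
      ⟨ih.count.comp hi, ih.privMean.comp hi, ih.arm.comp hi, ih.start.comp hi, ih.goal.comp hi,
        ih.rewardSum.comp hi⟩
    exact (ih'.beginRound σ α ε n).endRound (by fun_prop) (by fun_prop)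

theorem measurable_next [NeZero K] (σ : ArgmaxRule K) (α ε : ℝ) (n : ℕ) :
    Measurable fun h => (nextArm σ α ε n h, nextCount σ α ε n h) := by
  have h1 := ((measState_state σ α ε n).beginRound σ α ε n).arm
  exact h1.prodMk ((measurable_apply_arm (measState_state σ α ε n).count h1).add_const 1)

/-! ### Interaction with the environment and regret -/

/-- The law of a round in which arm `p.1` is played for the `p.2`-th time: the reward is drawn from
`ν p.1`, and independently of it the noise is drawn from `Lap(2 / (ε * p.2))`. The algorithm uses
the noise only if the round ends an episode. -/
def roundKernel (ν : Fin K → Measure ℝ) (ε : ℝ) : Kernel (Fin K × ℕ) (Round K) :=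
  Kernel.ofFunOfCountable fun p =>
    (Measure.dirac p.1).prod ((ν p.1).prod (laplace (2 / (ε * (p.2 : ℝ)))))

/-- The conditional law of round `n + 1` given the first `n` rounds. -/
def stepKernel [NeZero K] (σ : ArgmaxRule K) (α ε : ℝ) (ν : Fin K → Measure ℝ) (n : ℕ) :
    Kernel (Fin n → Round K) (Round K) :=
  (roundKernel ν ε).comap (fun h => (nextArm σ α ε n h, nextCount σ α ε n h))
    (measurable_next σ α ε n)

/-- The law of the first `n` rounds of the interaction of AdaP-UCB, with parameters `α` and `ε`,
with the bandit environment `ν`. -/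
def law [NeZero K] (σ : ArgmaxRule K) (α ε : ℝ) (ν : Fin K → Measure ℝ) :
    (n : ℕ) → Measure (Fin n → Round K)
  | 0 => Measure.dirac (fun i => i.elim0)
  | n + 1 => ((law σ α ε ν n).compProd (stepKernel σ α ε ν n)).map
      (fun p => (Fin.snoc p.1 p.2 : Fin (n + 1) → Round K))

instance (ν : Fin K → Measure ℝ) [∀ a, IsProbabilityMeasure (ν a)] (ε : ℝ) :
    IsMarkovKernel (roundKernel ν ε) :=
  ⟨fun p => by
    change IsProbabilityMeasure
      ((Measure.dirac p.1).prod ((ν p.1).prod (laplace (2 / (ε * (p.2 : ℝ))))))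
    infer_instance⟩

instance [NeZero K] (σ : ArgmaxRule K) (α ε : ℝ) (ν : Fin K → Measure ℝ)
    [∀ a, IsProbabilityMeasure (ν a)] (n : ℕ) : IsMarkovKernel (stepKernel σ α ε ν n) := by
  unfold stepKernel
  infer_instance

instance [NeZero K] (σ : ArgmaxRule K) (α ε : ℝ) (ν : Fin K → Measure ℝ)
    [∀ a, IsProbabilityMeasure (ν a)] (n : ℕ) : IsProbabilityMeasure (law σ α ε ν n) := by
  induction n with
  | zero => unfold law; infer_instance
  | succ n ih =>
    unfold law
    refine Measure.isProbabilityMeasure_map (Measurable.aemeasurable ?_)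
    rw [measurable_pi_iff]
    intro i
    refine Fin.lastCases ?_ (fun j => ?_) i
    · simpa using measurable_snd
    · simp only [Fin.snoc_castSucc]
      fun_prop

/-- The mean reward `μ_a` of arm `a`. -/
def mean (ν : Fin K → Measure ℝ) (a : Fin K) : ℝ := ∫ x, x ∂(ν a)

/-- The largest mean reward `μ^*`. -/
def bestMean (ν : Fin K → Measure ℝ) : ℝ := ⨆ a, mean ν a

/-- The suboptimality gap `Δ_a`. -/
def gap (ν : Fin K → Measure ℝ) (a : Fin K) : ℝ := bestMean ν - mean ν a

/-- The regret of AdaP-UCB at horizon `T`: `T μ^* - E[R_1 + ... + R_T]`. -/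
def regret [NeZero K] (σ : ArgmaxRule K) (α ε : ℝ) (ν : Fin K → Measure ℝ) (T : ℕ) : ℝ :=
  T * bestMean ν - ∫ h, ∑ t, (h t).2.1 ∂(law σ α ε ν T)

/-- The minimax lower bound for bandits with `K` arms under `ε`-global differential privacy. -/
def minimaxLowerBound (K T : ℕ) (ε : ℝ) : ℝ :=
  max (1 / 27 * Real.sqrt (T * ((K : ℝ) - 1))) (1 / 131 * (((K : ℝ) - 1) / ε))

end AdaP

end

noncomputable section

open MeasureTheory ProbabilityTheory

namespace AdaP

variable {K : ℕ}

/-! ### Concentration of a single round -/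

/-! The regret equals the expected sum of gap times number of plays, so each arm can be treated
separately. Arm counts are powers of two whenever a new episode starts, so the private mean of an
arm with count `N = 2 ^ j` averages the `N - N / 2` fresh rewards of one dyadic block and carries
one Laplace noise. For fixed `j` no union over random counts is needed: an exponential
supermartingale (`deviationPotential`), run from the first round, combines Hoeffding's lemma with
the Laplace tail and bounds the probability that this mean leaves its confidence interval in a given
direction before round `n + 1` by `2 * (n + 1) ^ (-α)` (`measure_deviates_le`).

If an episode of arm `a` starts while the relevant means are accurate, the usual UCB chain gives
`gap ≤ 2 * radius`. Doubling the count `N` then costs at most `4 * N * radius`, which is `4 * sqrt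
(α * N * log t) + 8 * α * log t / ε` and no longer involves the gap. An episode that starts in a bad
round after `n` rounds has length at most `n`. Bad rounds have probability at most `4 * n * (n + 1)
^ (-α)`, so the expected loss is a convergent series precisely because `α > 3`. Cauchy–Schwarz over
the arms turns the square roots into `sqrt (α * K * T * log T)`.

The comparison with the lower bound is elementary: the gaps sum to at most `K - 1 ≤ sqrt (T * (K -
1))`, `K ≤ 2 * (K - 1)`, and `log T ≥ 1 / 2`. -/

theorem lintegral_laplacePDF {b : ℝ} (hb : 0 < b) :
    ∫⁻ x, ENNReal.ofReal (laplacePDF b x) = 1 := by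
  have h := measure_univ (μ := laplace b)
  rwa [laplace, if_pos hb, withDensity_apply _ MeasurableSet.univ, Measure.restrict_univ] at h

/-- Beyond `y` the density is `exp (-(y / b))` times its translate by `κ * y`, and the translate has
total mass one. The sharp factor 1/2 is given up. -/
theorem laplace_tail {b y κ : ℝ} (hb : 0 < b) (hy : 0 ≤ y) (hκ : κ = 1 ∨ κ = -1) :
    laplace b {z | y < κ * z} ≤ ENNReal.ofReal (Real.exp (-(y / b))) := by
  have hm : MeasurableSet {z : ℝ | y < κ * z} :=
    measurableSet_lt measurable_const (measurable_const.mul measurable_id)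
  have hpdf : ∀ z ∈ {z : ℝ | y < κ * z}, ENNReal.ofReal (laplacePDF b z) ≤
      ENNReal.ofReal (Real.exp (-(y / b))) * ENNReal.ofReal (laplacePDF b (z - κ * y)) := by
    intro z hz
    rw [← ENNReal.ofReal_mul (Real.exp_pos _).le]
    refine ENNReal.ofReal_le_ofReal (le_of_eq ?_)
    have habs : |z| = y + |z - κ * y| := by
      rcases hκ with rfl | rfl <;> simp only [Set.mem_ofPred_eq] at hz
      · rw [abs_of_pos (by linarith), abs_of_pos (by linarith)]; ring
      · rw [abs_of_neg (by linarith), abs_of_neg (by linarith)]; ring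
    have hexp : Real.exp (-((y + |z - κ * y|) / b)) =
        Real.exp (-(y / b)) * Real.exp (-(|z - κ * y| / b)) := by
      rw [← Real.exp_add]; congr 1; ring
    rw [laplacePDF, laplacePDF, habs, hexp]
    ring
  rw [laplace, if_pos hb, withDensity_apply _ hm]
  calc ∫⁻ z in {z : ℝ | y < κ * z}, ENNReal.ofReal (laplacePDF b z)
      ≤ ∫⁻ z in {z : ℝ | y < κ * z}, ENNReal.ofReal (Real.exp (-(y / b))) *
          ENNReal.ofReal (laplacePDF b (z - κ * y)) := setLIntegral_mono' hm hpdf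
    _ ≤ ∫⁻ z, ENNReal.ofReal (Real.exp (-(y / b))) *
          ENNReal.ofReal (laplacePDF b (z - κ * y)) := setLIntegral_le_lintegral _ _
    _ = ENNReal.ofReal (Real.exp (-(y / b))) := by
      rw [lintegral_const_mul' _ _ ENNReal.ofReal_ne_top,
        lintegral_sub_right_eq_self (fun z => ENNReal.ofReal (laplacePDF b z)),
        lintegral_laplacePDF hb, mul_one]

/-- Hoeffding's lemma on the unit interval, in terms of the lower integral. -/
theorem lintegral_exp_mul_sub_mean_le {P : Measure ℝ} [IsProbabilityMeasure P]
    (hP : ∀ᵐ x ∂P, x ∈ Set.Icc (0 : ℝ) 1) (θ : ℝ) :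
    ∫⁻ r, ENNReal.ofReal (Real.exp (θ * (r - ∫ x, x ∂P))) ∂P ≤
      ENNReal.ofReal (Real.exp (θ ^ 2 / 8)) := by
  have h := hasSubgaussianMGF_of_mem_Icc (X := fun x : ℝ => x) (μ := P) aemeasurable_id' hP
  rw [← ofReal_integral_eq_lintegral_ofReal (h.integrable_exp_mul θ)
    (Filter.Eventually.of_forall fun _ => (Real.exp_pos _).le)]
  refine ENNReal.ofReal_le_ofReal ((h.mgf_le θ).trans (Real.exp_le_exp.2 (le_of_eq ?_)))
  norm_num
  ring

/-! ### Integration against the law of the interaction -/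

/-- The joint law of the reward and of the noise of a round that begins in state `s`. -/
def rewardNoise (ν : Fin K → Measure ℝ) (ε : ℝ) (s : State K) : Measure (ℝ × ℝ) :=
  (ν s.arm).prod (laplace (2 / (ε * ((s.count s.arm + 1 : ℕ) : ℝ))))

instance (ν : Fin K → Measure ℝ) [∀ a, IsProbabilityMeasure (ν a)] (ε : ℝ) (s : State K) :
    IsProbabilityMeasure (rewardNoise ν ε s) := by
  unfold rewardNoise; infer_instance

theorem beginRound_count (σ : ArgmaxRule K) (α ε : ℝ) (n : ℕ) (s : State K) :
    (beginRound σ α ε n s).count = s.count := by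
  unfold beginRound; split_ifs <;> rfl

theorem beginRound_privMean (σ : ArgmaxRule K) (α ε : ℝ) (n : ℕ) (s : State K) :
    (beginRound σ α ε n s).privMean = s.privMean := by
  unfold beginRound; split_ifs <;> rfl

theorem count_endRound (s : State K) (r z : ℝ) (a : Fin K) :
    (endRound s r z).count a = s.count a + if a = s.arm then 1 else 0 := by
  by_cases h : a = s.arm
  · subst h; simp [endRound]
  · simp [endRound, h]

theorem measurable_snoc_round {n : ℕ} :
    Measurable fun p : (Fin n → Round K) × Round K =>
      (Fin.snoc p.1 p.2 : Fin (n + 1) → Round K) := by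
  rw [measurable_pi_iff]
  intro i
  refine Fin.lastCases ?_ (fun j => ?_) i
  · simpa using measurable_snd
  · simp only [Fin.snoc_castSucc]
    fun_prop

theorem measurable_init_round {n : ℕ} :
    Measurable fun h : Fin (n + 1) → Round K => (Fin.init h : Fin n → Round K) :=
  measurable_pi_iff.2 fun i => measurable_pi_apply i.castSucc

section Law

variable [NeZero K] (σ : ArgmaxRule K) (α ε : ℝ) (ν : Fin K → Measure ℝ)

theorem stepKernel_apply [∀ a, IsProbabilityMeasure (ν a)] (n : ℕ) (h : Fin n → Round K) :
    stepKernel σ α ε ν n h =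
      (rewardNoise ν ε (beginRound σ α ε n (state σ α ε n h))).map
        (Prod.mk (nextArm σ α ε n h)) := by
  rw [← Measure.dirac_prod, rewardNoise, beginRound_count]
  rfl

theorem state_snoc (n : ℕ) (h : Fin n → Round K) (r : Round K) :
    state σ α ε (n + 1) (Fin.snoc h r) =
      endRound (beginRound σ α ε n (state σ α ε n h)) r.2.1 r.2.2 := by
  simp [state]

variable [∀ a, IsProbabilityMeasure (ν a)]

theorem lintegral_law_succ {n : ℕ} {F : (Fin (n + 1) → Round K) → ENNReal} (hF : Measurable F) :
    ∫⁻ h, F h ∂(law σ α ε ν (n + 1)) =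
      ∫⁻ h, ∫⁻ p, F (Fin.snoc h (nextArm σ α ε n h, p))
        ∂(rewardNoise ν ε (beginRound σ α ε n (state σ α ε n h))) ∂(law σ α ε ν n) := by
  rw [law, lintegral_map hF measurable_snoc_round]
  refine (Measure.lintegral_compProd (hF.comp measurable_snoc_round)).trans ?_
  refine lintegral_congr fun h => ?_
  rw [stepKernel_apply]
  exact lintegral_map (hF.comp (measurable_snoc_round.comp measurable_prodMk_left))
    measurable_prodMk_left

/-- Consistency of the finite-horizon laws. It allows events about the past to be evaluated under
the law of the shorter history, with no measure on infinite histories. -/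
theorem law_map_init (n : ℕ) :
    (law σ α ε ν (n + 1)).map (fun h => (Fin.init h : Fin n → Round K)) = law σ α ε ν n := by
  rw [law, Measure.map_map measurable_init_round measurable_snoc_round]
  have : ((fun h : Fin (n + 1) → Round K => (Fin.init h : Fin n → Round K)) ∘
      fun p : (Fin n → Round K) × Round K => (Fin.snoc p.1 p.2 : Fin (n + 1) → Round K)) =
      Prod.fst := by
    funext p
    simp
  rw [this]
  exact Measure.fst_compProd _ _

/-- A potential that does not increase in conditional expectation does not increase in
expectation. -/
theorem lintegral_state_le {F : State K → ENNReal}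
    (hF : ∀ n, Measurable fun h => F (state σ α ε n h))
    (hstep : ∀ n h, ∫⁻ p, F (endRound (beginRound σ α ε n (state σ α ε n h)) p.1 p.2)
      ∂(rewardNoise ν ε (beginRound σ α ε n (state σ α ε n h))) ≤ F (state σ α ε n h)) (n : ℕ) :
    ∫⁻ h, F (state σ α ε n h) ∂(law σ α ε ν n) ≤ F (initState K) := by
  induction n with
  | zero => simp [state]
  | succ n ih =>
    rw [lintegral_law_succ σ α ε ν (hF (n + 1))]
    simp only [state_snoc]
    exact (lintegral_mono fun h => hstep n h).trans ih

theorem ae_law_reward_mem (hν : ∀ a, ∀ᵐ x ∂(ν a), x ∈ Set.Icc (0 : ℝ) 1) (n : ℕ) :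
    ∀ᵐ h ∂(law σ α ε ν n), ∀ t, (h t).2.1 ∈ Set.Icc (0 : ℝ) 1 := by
  induction n with
  | zero => exact Filter.Eventually.of_forall fun h t => t.elim0
  | succ n ih =>
    have hset : ∀ m, MeasurableSet {h : Fin m → Round K | ∀ t, (h t).2.1 ∈ Set.Icc (0 : ℝ) 1} := by
      intro m
      rw [Set.ofPred_forall]
      refine MeasurableSet.iInter fun t => ?_
      have : Measurable fun h : Fin m → Round K => (h t).2.1 := by fun_prop
      exact this measurableSet_Icc
    rw [law, ae_map_iff measurable_snoc_round.aemeasurable (hset _)]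
    refine Measure.ae_compProd_of_ae_ae (measurable_snoc_round (hset _)) ?_
    filter_upwards [ih] with h hh
    rw [stepKernel_apply, ae_map_iff measurable_prodMk_left.aemeasurable]
    · have hfst : ∀ᵐ p ∂(rewardNoise ν ε (beginRound σ α ε n (state σ α ε n h))),
          p.1 ∈ Set.Icc (0 : ℝ) 1 :=
        Measure.quasiMeasurePreserving_fst.ae (hν _)
      filter_upwards [hfst] with p hp t
      refine Fin.lastCases ?_ (fun j => ?_) t
      · simpa using hp
      · simpa using hh j
    · exact (measurable_snoc_round.comp measurable_prodMk_left) (hset _)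

/-! ### Play counts and the expected total reward -/

theorem measurable_count (n : ℕ) (a : Fin K) :
    Measurable fun h => (((state σ α ε n h).count a : ℕ) : ℝ) :=
  measurable_from_nat.comp ((measurable_pi_apply a).comp (measState_state σ α ε n).count)

theorem integrable_sum_reward (hν : ∀ a, ∀ᵐ x ∂(ν a), x ∈ Set.Icc (0 : ℝ) 1) (n : ℕ) :
    Integrable (fun h => ∑ t, (h t).2.1) (law σ α ε ν n) := by
  refine integrable_finsetSum _ fun t _ => ?_
  have hm : Measurable fun h : Fin n → Round K => (h t).2.1 := by fun_prop
  refine Integrable.of_mem_Icc 0 1 hm.aemeasurable ?_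
  filter_upwards [ae_law_reward_mem σ α ε ν hν n] with h hh using hh t

theorem sum_count_state (n : ℕ) (h : Fin n → Round K) : ∑ a, (state σ α ε n h).count a = n := by
  induction n with
  | zero => simp [state, initState]
  | succ n ih =>
    simp only [state, count_endRound, beginRound_count, Finset.sum_add_distrib, ih,
      Finset.sum_ite_eq', Finset.mem_univ, if_true]

theorem count_state_le (n : ℕ) (h : Fin n → Round K) (a : Fin K) :
    (state σ α ε n h).count a ≤ n := by
  conv_rhs => rw [← sum_count_state σ α ε n h]
  exact Finset.single_le_sum (f := (state σ α ε n h).count) (fun _ _ => Nat.zero_le _)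
    (Finset.mem_univ a)

theorem integrable_count (n : ℕ) (a : Fin K) :
    Integrable (fun h => (((state σ α ε n h).count a : ℕ) : ℝ)) (law σ α ε ν n) := by
  refine Integrable.of_mem_Icc 0 n (measurable_count σ α ε n a).aemeasurable ?_
  refine Filter.Eventually.of_forall fun h => ⟨Nat.cast_nonneg _, ?_⟩
  exact_mod_cast count_state_le σ α ε n h a

/-- A Wald identity: total reward minus the sum of the means of the arms played is a martingale
started at zero, since the arm is fixed by the past before the reward is drawn. -/
theorem integral_sum_reward (hν : ∀ a, ∀ᵐ x ∂(ν a), x ∈ Set.Icc (0 : ℝ) 1) (n : ℕ) :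
    ∫ h, ∑ t, (h t).2.1 ∂(law σ α ε ν n) =
      ∫ h, ∑ a, mean ν a * ((state σ α ε n h).count a : ℝ) ∂(law σ α ε ν n) := by
  have hintc : ∀ m, Integrable
      (fun h => ∑ a, mean ν a * ((state σ α ε m h).count a : ℝ)) (law σ α ε ν m) := fun m =>
    integrable_finsetSum _ fun a _ => (integrable_count σ α ε ν m a).const_mul _
  have hint : ∀ m, Integrable (fun h => ∑ t, (h t).2.1 -
      ∑ a, mean ν a * ((state σ α ε m h).count a : ℝ)) (law σ α ε ν m) := fun m =>
    (integrable_sum_reward σ α ε ν hν m).sub (hintc m)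
  rw [← sub_eq_zero, ← integral_sub (integrable_sum_reward σ α ε ν hν n) (hintc n)]
  induction n with
  | zero => simp [state, initState]
  | succ n ih =>
    have hi := hint (n + 1)
    rw [law] at hi ⊢
    rw [integral_map measurable_snoc_round.aemeasurable hi.aestronglyMeasurable]
    rw [integrable_map_measure hi.aestronglyMeasurable measurable_snoc_round.aemeasurable] at hi
    refine (Measure.integral_compProd hi).trans (Eq.trans ?_ ih)
    refine integral_congr_ae (Filter.Eventually.of_forall fun h => ?_)
    simp only [Function.comp_apply, state_snoc, count_endRound, beginRound_count, Fin.sum_univ_castSucc,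
      Fin.snoc_castSucc, Fin.snoc_last, Nat.cast_add, mul_add, Finset.sum_add_distrib,
      Nat.cast_ite, Nat.cast_one, Nat.cast_zero, mul_ite, mul_one, mul_zero, Finset.sum_ite_eq',
      Finset.mem_univ, if_true]
    rw [stepKernel_apply, integral_map measurable_prodMk_left.aemeasurable (by fun_prop)]
    set s := beginRound σ α ε n (state σ α ε n h) with hs
    have hr : Integrable (fun p : ℝ × ℝ => p.1) (rewardNoise ν ε s) :=
      (Integrable.of_mem_Icc 0 1 aemeasurable_id' (hν s.arm)).comp_fst _
    have hmean : ∫ p : ℝ × ℝ, p.1 ∂(rewardNoise ν ε s) = mean ν s.arm := by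
      rw [rewardNoise, integral_fun_fst (fun x : ℝ => x)]
      simp [mean]
    have : ∀ p : ℝ × ℝ, ∑ t, (h t).2.1 + p.1 - (∑ a, mean ν a * ((state σ α ε n h).count a : ℝ) +
        mean ν s.arm) = p.1 + (∑ t, (h t).2.1 - ∑ a, mean ν a * ((state σ α ε n h).count a : ℝ) -
        mean ν s.arm) := fun p => by ring
    simp only [this]
    rw [integral_add hr (integrable_const _), hmean]
    simp

end Law

/-! ### Deterministic invariants of the algorithm -/

/-- A count strictly between `2 ^ j / 2` and `2 ^ j` therefore reveals an arm in the middle of an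
episode. Floor division makes `j = 0` fit, with block start 0. -/
theorem not_half_lt_of_dyadic {c j : ℕ} (hc : c = 0 ∨ ∃ i, c = 2 ^ i) (h1 : 2 ^ j / 2 < c) :
    2 ^ j ≤ c := by
  rcases hc with rfl | ⟨i, rfl⟩
  · omega
  · by_contra! h
    have hij : i < j := (Nat.pow_lt_pow_iff_right (by norm_num)).1 h
    obtain ⟨k, rfl⟩ := Nat.exists_eq_add_of_lt hij
    have : 2 ^ i ≤ 2 ^ (i + k) := Nat.pow_le_pow_right (by norm_num) (by omega)
    rw [pow_succ, Nat.mul_div_cancel _ (by norm_num)] at h1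
    omega

/-- The blocks `[0, 1)`, `[1, 2)`, `[2, 4)`, ... are disjoint, so the count alone identifies the
running episode. -/
theorem dyadic_block_unique {c i j : ℕ} (hi : 2 ^ i / 2 ≤ c) (hi' : c < 2 ^ i)
    (hj : 2 ^ j / 2 ≤ c) (hj' : c < 2 ^ j) : i = j := by
  have key : ∀ {i j : ℕ}, c < 2 ^ i → 2 ^ j / 2 ≤ c → j ≤ i := by
    intro i j h1 h2
    by_contra! h
    obtain ⟨k, rfl⟩ := Nat.exists_eq_add_of_lt h
    have : 2 ^ i ≤ 2 ^ (i + k) := Nat.pow_le_pow_right (by norm_num) (by omega)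
    rw [pow_succ, Nat.mul_div_cancel _ (by norm_num)] at h2
    omega
  exact le_antisymm (key hj' hi) (key hi' hj)

/-- What is known about the state after `n` rounds. -/
structure Reachable (n : ℕ) (s : State K) : Prop where
  count_of_le : n ≤ K → ∀ a : Fin K, s.count a = if (a : ℕ) < n then 1 else 0
  one_le_count : K ≤ n → ∀ a, 1 ≤ s.count a
  dyadic : ∀ a, a ≠ s.arm → s.count a = 0 ∨ ∃ i, s.count a = 2 ^ i
  episode : n ≠ 0 → ∃ i, s.goal = 2 ^ i ∧ s.start = 2 ^ i / 2 ∧ s.start < s.count s.arm ∧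
    s.count s.arm ≤ s.goal

/-- What is known about the state at the beginning of a round. -/
structure Ready (s : State K) : Prop where
  dyadic : ∀ a, a ≠ s.arm → s.count a = 0 ∨ ∃ i, s.count a = 2 ^ i
  episode : ∃ i, s.goal = 2 ^ i ∧ s.start = 2 ^ i / 2 ∧ s.start ≤ s.count s.arm ∧
    s.count s.arm < s.goal
  rewardSum : s.count s.arm = s.start → s.rewardSum = 0

theorem Reachable.dyadic_of_goal_le {n : ℕ} {s : State K} (hs : Reachable n s) (hn : n ≠ 0)
    (h : s.goal ≤ s.count s.arm) (a : Fin K) : s.count a = 0 ∨ ∃ i, s.count a = 2 ^ i := by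
  by_cases ha : a = s.arm
  · obtain ⟨i, hi, -, -, hle⟩ := hs.episode hn
    exact Or.inr ⟨i, by rw [ha, ← hi]; omega⟩
  · exact hs.dyadic a ha

theorem Reachable.ready [NeZero K] {n : ℕ} {s : State K} (hs : Reachable n s) (σ : ArgmaxRule K)
    (α ε : ℝ) : Ready (beginRound σ α ε n s) := by
  by_cases h : n < K
  · have hc := hs.count_of_le h.le
    simp only [beginRound, h, dite_true]
    -- The initial episodes of length one are the dyadic block with exponent 0, from `1 / 2 = 0` to
    -- 1.
    refine ⟨fun a _ => ?_, ⟨0, by simp [hc]⟩, fun _ => rfl⟩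
    simp only [hc]
    split_ifs
    · exact Or.inr ⟨0, rfl⟩
    · exact Or.inl rfl
  · have hn : n ≠ 0 := by have := NeZero.ne K; omega
    by_cases hg : s.count s.arm < s.goal
    · simp only [beginRound, h, dite_false, hg, if_true]
      obtain ⟨i, h1, h2, h3, h4⟩ := hs.episode hn
      -- In a continuing episode at least one round has been played, so the condition on the reward
      -- sum is vacuous.
      exact ⟨hs.dyadic, ⟨i, h1, h2, h3.le, hg⟩, fun h => absurd h h3.ne'⟩
    · simp only [beginRound, h, dite_false, hg, if_false]
      have hd := hs.dyadic_of_goal_le hn (not_lt.1 hg)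
      refine ⟨fun a _ => hd a, ?_, fun _ => rfl⟩
      have hpos := hs.one_le_count (not_lt.1 h) (σ.select (index α ε (n + 1) s))
      rcases hd (σ.select (index α ε (n + 1) s)) with h0 | ⟨i, hi⟩
      · omega
      · refine ⟨i + 1, ?_, ?_, le_rfl, ?_⟩ <;> simp only [hi, pow_succ] <;> omega

theorem endRound_arm (s : State K) (r z : ℝ) : (endRound s r z).arm = s.arm := rfl

theorem endRound_goal (s : State K) (r z : ℝ) : (endRound s r z).goal = s.goal := rfl

theorem Ready.episode_endRound {s : State K} (hs : Ready s) (r z : ℝ) :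
    (∀ a, a ≠ (endRound s r z).arm →
      (endRound s r z).count a = 0 ∨ ∃ i, (endRound s r z).count a = 2 ^ i) ∧
    ∃ i, (endRound s r z).goal = 2 ^ i ∧ (endRound s r z).start = 2 ^ i / 2 ∧
      (endRound s r z).start < (endRound s r z).count (endRound s r z).arm ∧
      (endRound s r z).count (endRound s r z).arm ≤ (endRound s r z).goal := by
  constructor
  · intro a ha
    rw [endRound_arm] at ha
    simpa [count_endRound, ha] using hs.dyadic a ha
  · obtain ⟨i, h1, h2, h3, h4⟩ := hs.episode
    refine ⟨i, h1, h2, ?_, ?_⟩ <;> rw [count_endRound, endRound_arm, if_pos rfl]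
    · exact Nat.lt_succ_of_le h3
    · exact h4

theorem reachable_state [NeZero K] (σ : ArgmaxRule K) (α ε : ℝ) (n : ℕ) (h : Fin n → Round K) :
    Reachable n (state σ α ε n h) := by
  induction n with
  | zero =>
    refine ⟨fun _ a => rfl, fun hK => ?_, fun a _ => Or.inl rfl, fun h => absurd rfl h⟩
    have := NeZero.ne K
    omega
  | succ n ih =>
    specialize ih (Fin.init h)
    set s := state σ α ε n (Fin.init h) with hs
    obtain ⟨h3, h4⟩ := (ih.ready σ α ε).episode_endRound (h (Fin.last n)).2.1 (h (Fin.last n)).2.2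
    have h1 : n + 1 ≤ K → ∀ a : Fin K, (state σ α ε (n + 1) h).count a =
        if (a : ℕ) < n + 1 then 1 else 0 := by
      intro hn a
      have hn' : n < K := hn
      simp only [state, ← hs, count_endRound, beginRound_count, ih.count_of_le hn'.le a]
      simp only [beginRound, hn', dite_true, Fin.ext_iff]
      split_ifs <;> omega
    refine ⟨h1, fun hK a => ?_, h3, fun _ => h4⟩
    rcases hK.lt_or_eq with hlt | heq
    · have := ih.one_le_count (Nat.lt_succ_iff.1 hlt) a
      simp only [state, ← hs, count_endRound, beginRound_count]
      omega
    · rw [h1 heq.ge a, if_pos (by rw [← heq]; exact a.2)]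

/-! ### Concentration of the private means -/

/-- The exponential as an extended nonnegative real. -/
def eexp (x : ℝ) : ENNReal := ENNReal.ofReal (Real.exp x)

theorem eexp_add (x y : ℝ) : eexp (x + y) = eexp x * eexp y := by
  rw [eexp, Real.exp_add, ENNReal.ofReal_mul (Real.exp_pos _).le]; rfl

theorem eexp_mono {x y : ℝ} (h : x ≤ y) : eexp x ≤ eexp y :=
  ENNReal.ofReal_le_ofReal (Real.exp_le_exp.2 h)

theorem one_le_eexp {x : ℝ} (h : 0 ≤ x) : 1 ≤ eexp x := by
  simpa [eexp] using eexp_mono h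

theorem measurable_eexp : Measurable eexp := by unfold eexp; fun_prop

/-- A supermartingale that dominates the conditional probability that the private mean of arm `a`
released after its `N`-th play deviates from `μ` by more than `x + y` in the direction `κ`. -/
def deviationPotential (a : Fin K) (N : ℕ) (μ κ x y ε : ℝ) (s : State K) : ENNReal :=
  if s.count a ≤ N / 2 then
    eexp (-(2 * ((N : ℝ) - (N / 2 : ℕ)) * x ^ 2)) + eexp (-(y * (ε * N) / 2))
  else if s.count a < N then
    -- Chernoff exponent with parameter `4 * x`: each reward still to come is allotted its Hoeffding
    -- factor `exp (2 * x ^ 2)`, as `(4 * x) ^ 2 / 8 = 2 * x ^ 2`.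
    eexp (4 * x * κ * (s.rewardSum - ((s.count a : ℝ) - (N / 2 : ℕ)) * μ)
      + ((N : ℝ) - s.count a) * (2 * x ^ 2) - 4 * ((N : ℝ) - (N / 2 : ℕ)) * x ^ 2)
      + eexp (-(y * (ε * N) / 2))
  else if s.count a = N then
    if x + y < κ * (s.privMean a - μ) then 1 else 0
  else 0

theorem MeasState.measurable_deviationPotential {Ω : Type*} [MeasurableSpace Ω] {f : Ω → State K}
    (hf : MeasState f) (a : Fin K) (N : ℕ) (μ κ x y ε : ℝ) :
    Measurable fun ω => deviationPotential a N μ κ x y ε (f ω) := by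
  have hc : Measurable fun ω => (f ω).count a := (measurable_pi_apply a).comp hf.count
  have hc' : Measurable fun ω => ((f ω).count a : ℝ) := measurable_from_nat.comp hc
  have hp : Measurable fun ω => (f ω).privMean a := (measurable_pi_apply a).comp hf.privMean
  have hr := hf.rewardSum
  unfold deviationPotential
  refine Measurable.ite (measurableSet_le hc measurable_const) measurable_const ?_
  refine Measurable.ite (measurableSet_lt hc measurable_const) ?_ ?_
  · exact (measurable_eexp.comp (by fun_prop)).add measurable_const
  · refine Measurable.ite (measurableSet_eq_fun hc measurable_const) ?_ measurable_const
    exact Measurable.ite (measurableSet_lt measurable_const (by fun_prop)) measurable_const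
      measurable_const

/-- The reward sum is read only strictly inside the block, so resets at episode boundaries and
rewards of other arms do not disturb the potential. -/
theorem deviationPotential_congr {a : Fin K} {N : ℕ} {μ κ x y ε : ℝ} {s s' : State K}
    (hc : s.count a = s'.count a) (hp : s.privMean a = s'.privMean a)
    (hr : N / 2 < s.count a → s.count a < N → s.rewardSum = s'.rewardSum) :
    deviationPotential a N μ κ x y ε s = deviationPotential a N μ κ x y ε s' := by
  unfold deviationPotential
  rw [← hc, ← hp]
  split_ifs with h1 h2
  · rfl
  · rw [hr (not_le.1 h1) h2]
  all_goals rfl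

/-- Strictly inside the block the count is not dyadic, so the episode must be running and the state
is left untouched. Elsewhere the potential ignores everything that a new episode resets. -/
theorem deviationPotential_beginRound [NeZero K] {n : ℕ} {s : State K} (hs : Reachable n s)
    (σ : ArgmaxRule K) (α ε : ℝ) (a : Fin K) (j : ℕ) (μ κ x y : ℝ) :
    deviationPotential a (2 ^ j) μ κ x y ε (beginRound σ α ε n s) =
      deviationPotential a (2 ^ j) μ κ x y ε s := by
  refine deviationPotential_congr (by rw [beginRound_count]) (by rw [beginRound_privMean]) ?_
  rw [beginRound_count]
  intro h1 h2
  have hnd : ¬ (s.count a = 0 ∨ ∃ i, s.count a = 2 ^ i) := fun hd =>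
    absurd (not_half_lt_of_dyadic hd h1) (not_le.2 h2)
  have hK : ¬ n < K := by
    intro hK
    refine hnd ?_
    rw [hs.count_of_le hK.le]
    split_ifs
    · exact Or.inr ⟨0, rfl⟩
    · exact Or.inl rfl
  have hn : n ≠ 0 := by have := NeZero.ne K; omega
  have hg : s.count s.arm < s.goal := by
    by_contra hg
    exact hnd (hs.dyadic_of_goal_le hn (not_lt.1 hg) a)
  simp [beginRound, hK, hg]

theorem lintegral_eexp_reward_le {P Q : Measure ℝ} [IsProbabilityMeasure P]
    [IsProbabilityMeasure Q] (hP : ∀ᵐ x ∂P, x ∈ Set.Icc (0 : ℝ) 1) (A B θ : ℝ)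
    (hB : A + θ ^ 2 / 8 ≤ B) :
    ∫⁻ p, eexp (A + θ * (p.1 - ∫ x, x ∂P)) ∂(P.prod Q) ≤ eexp B := by
  have hm : Measurable fun r : ℝ => eexp (θ * (r - ∫ x, x ∂P)) :=
    measurable_eexp.comp (by fun_prop)
  simp only [eexp_add]
  rw [lintegral_const_mul' (eexp A) _ ENNReal.ofReal_ne_top,
    (measurePreserving_fst (μ := P) (ν := Q)).lintegral_comp hm]
  calc eexp A * ∫⁻ r, eexp (θ * (r - ∫ x, x ∂P)) ∂P
      ≤ eexp A * eexp (θ ^ 2 / 8) := by gcongr; exact lintegral_exp_mul_sub_mean_le hP θ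
    _ ≤ eexp B := by rw [← eexp_add]; exact eexp_mono hB

/-- The supermartingale step. A reward inside the block uses up one factor `exp (2 * x ^ 2)` by
Hoeffding's lemma. At the last play, a deviation above `x + y` forces either the empirical mean to
deviate by more than `x`, where the exponential is at least one, or the noise to exceed `y`, which
has the Laplace tail probability. In all other rounds the potential is constant or drops to zero. -/
theorem lintegral_deviationPotential_endRound_le {s : State K} (hs : Ready s)
    {ν : Fin K → Measure ℝ} [∀ a, IsProbabilityMeasure (ν a)]
    (hν : ∀ a, ∀ᵐ x ∂(ν a), x ∈ Set.Icc (0 : ℝ) 1) {ε : ℝ} (hε : 0 < ε) (a : Fin K) (j : ℕ)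
    {κ x y : ℝ} (hκ : κ = 1 ∨ κ = -1) (hx : 0 ≤ x) (hy : 0 ≤ y) :
    ∫⁻ p, deviationPotential a (2 ^ j) (mean ν a) κ x y ε (endRound s p.1 p.2)
      ∂(rewardNoise ν ε s) ≤ deviationPotential a (2 ^ j) (mean ν a) κ x y ε s := by
  set N := 2 ^ j with hN
  have hκ2 : κ ^ 2 = 1 := by rcases hκ with rfl | rfl <;> norm_num
  by_cases ha : a = s.arm
  swap
  · have : ∀ p : ℝ × ℝ, deviationPotential a N (mean ν a) κ x y ε (endRound s p.1 p.2) =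
        deviationPotential a N (mean ν a) κ x y ε s := by
      intro p
      have hc : (endRound s p.1 p.2).count a = s.count a := by simp [count_endRound, ha]
      refine deviationPotential_congr hc ?_ fun h1 h2 => ?_
      · simp only [endRound]
        split_ifs
        · rw [Function.update_of_ne ha]
        · rfl
      · rw [hc] at h1 h2
        exact absurd (not_half_lt_of_dyadic (hs.dyadic a ha) h1) (not_le.2 h2)
    simp [this]
  subst ha
  set a := s.arm with ha
  set c := s.count a with hc
  have hcount : ∀ p : ℝ × ℝ, (endRound s p.1 p.2).count a = c + 1 := fun p => by
    simp [count_endRound, ← ha, ← hc]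
  have hNpos : 0 < N := by positivity
  by_cases h1 : c + 1 ≤ N / 2
  · simp only [deviationPotential, hcount, if_pos h1, ← hc, if_pos (show c ≤ N / 2 by omega)]
    simp
  by_cases h2 : N ≤ c
  · have : ∀ p : ℝ × ℝ, deviationPotential a N (mean ν a) κ x y ε (endRound s p.1 p.2) = 0 := by
      intro p
      rw [deviationPotential, hcount, if_neg h1, if_neg (by omega), if_neg (by omega)]
    simp [this]
  push Not at h1 h2
  obtain ⟨i, hg, hst, hlo, hhi⟩ := hs.episode
  rw [← ha, ← hc] at hlo hhi
  -- The count lies in the block of the current episode and in that of `2 ^ j`, so the two agree and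
  -- the goal is `N`.
  obtain rfl : i = j := dyadic_block_unique (hst ▸ hlo) (hg ▸ hhi) (by omega) h2
  rw [← hN] at hg hst
  /- In both remaining cases the potential at `s` has the exponential form. -/
  have hpot : deviationPotential a N (mean ν a) κ x y ε s =
      eexp (4 * x * κ * (s.rewardSum - ((c : ℝ) - (N / 2 : ℕ)) * mean ν a)
        + ((N : ℝ) - c) * (2 * x ^ 2) - 4 * ((N : ℝ) - (N / 2 : ℕ)) * x ^ 2)
        + eexp (-(y * (ε * N) / 2)) := by
    rw [deviationPotential, ← hc]
    by_cases hcN : c ≤ N / 2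
    · have hceq : c = N / 2 := by omega
      -- At the start of a block of length `m` the reward sum is still zero, and the exponent
      -- collapses to `2 * m * x ^ 2 - 4 * m * x ^ 2 = -2 * m * x ^ 2`.
      rw [if_pos hcN, hs.rewardSum (by rw [← ha, ← hc, hst, hceq]), hceq]
      congr 2
      ring
    · rw [if_neg hcN, if_pos h2]
  rw [hpot]
  have hexp : ∫⁻ p, eexp (4 * x * κ * (s.rewardSum - ((c : ℝ) - (N / 2 : ℕ)) * mean ν a)
        + ((N : ℝ) - (c + 1 : ℕ)) * (2 * x ^ 2) - 4 * ((N : ℝ) - (N / 2 : ℕ)) * x ^ 2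
        + 4 * x * κ * (p.1 - ∫ r, r ∂(ν a))) ∂(rewardNoise ν ε s) ≤
      eexp (4 * x * κ * (s.rewardSum - ((c : ℝ) - (N / 2 : ℕ)) * mean ν a)
        + ((N : ℝ) - c) * (2 * x ^ 2) - 4 * ((N : ℝ) - (N / 2 : ℕ)) * x ^ 2) := by
    refine lintegral_eexp_reward_le (hν a) _ _ _ (le_of_eq ?_)
    push_cast
    linear_combination 2 * x ^ 2 * hκ2
  have hmexp : Measurable fun p : ℝ × ℝ =>
      eexp (4 * x * κ * (s.rewardSum - ((c : ℝ) - (N / 2 : ℕ)) * mean ν a)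
        + ((N : ℝ) - (c + 1 : ℕ)) * (2 * x ^ 2) - 4 * ((N : ℝ) - (N / 2 : ℕ)) * x ^ 2
        + 4 * x * κ * (p.1 - ∫ r, r ∂(ν a))) := measurable_eexp.comp (by fun_prop)
  rcases (show c + 1 < N ∨ c + 1 = N by omega) with h3 | h3
  · have : ∀ p : ℝ × ℝ, deviationPotential a N (mean ν a) κ x y ε (endRound s p.1 p.2) =
        eexp (4 * x * κ * (s.rewardSum - ((c : ℝ) - (N / 2 : ℕ)) * mean ν a)
        + ((N : ℝ) - (c + 1 : ℕ)) * (2 * x ^ 2) - 4 * ((N : ℝ) - (N / 2 : ℕ)) * x ^ 2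
        + 4 * x * κ * (p.1 - ∫ r, r ∂(ν a))) + eexp (-(y * (ε * N) / 2)) := by
      intro p
      rw [deviationPotential, hcount, if_neg (not_le.2 h1), if_pos h3]
      congr 2
      simp only [endRound, mean]
      push_cast
      ring
    simp only [this]
    rw [lintegral_add_left hmexp]
    simp only [lintegral_const, measure_univ, mul_one]
    gcongr
  · have hm0 : (0 : ℝ) < (N : ℝ) - (N / 2 : ℕ) := by
      have : N / 2 < N := by omega
      have : ((N / 2 : ℕ) : ℝ) < N := by exact_mod_cast this
      linarith
    have hle : ∀ p : ℝ × ℝ, deviationPotential a N (mean ν a) κ x y ε (endRound s p.1 p.2) ≤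
        eexp (4 * x * κ * (s.rewardSum - ((c : ℝ) - (N / 2 : ℕ)) * mean ν a)
        + ((N : ℝ) - (c + 1 : ℕ)) * (2 * x ^ 2) - 4 * ((N : ℝ) - (N / 2 : ℕ)) * x ^ 2
        + 4 * x * κ * (p.1 - ∫ r, r ∂(ν a))) +
          {z : ℝ | y < κ * z}.indicator (fun _ => 1) p.2 := by
      intro p
      rw [deviationPotential, hcount, if_neg (not_le.2 h1), if_neg (by omega), if_pos h3]
      have hpm : (endRound s p.1 p.2).privMean a =
          (s.rewardSum + p.1) / ((N : ℝ) - (N / 2 : ℕ)) + p.2 := by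
        simp only [endRound]
        rw [← ha, ← hc, if_pos (by rw [hg, h3]), Function.update_self, hg, hst]
      rw [hpm]
      split_ifs with hdev
      swap
      · exact zero_le
      by_cases hz : y < κ * p.2
      · rw [Set.indicator_of_mem (by exact hz)]
        exact le_add_self
      · refine le_add_right (one_le_eexp ?_)
        -- The noise contributes at most `y`, so the empirical mean alone must exceed `x`.
        have hx' : x < κ * ((s.rewardSum + p.1) / ((N : ℝ) - (N / 2 : ℕ)) - mean ν a) := by
          nlinarith
        have hx'' : x * ((N : ℝ) - (N / 2 : ℕ)) <
            κ * (s.rewardSum + p.1 - ((N : ℝ) - (N / 2 : ℕ)) * mean ν a) := by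
          have := mul_lt_mul_of_pos_right hx' hm0
          calc _ < _ := this
            _ = _ := by field_simp
        have hcN : (N : ℝ) = c + 1 := by rw [← h3]; push_cast; ring
        have h4 := mul_le_mul_of_nonneg_left hx''.le (show 0 ≤ 4 * x by linarith)
        change 0 ≤ 4 * x * κ * (s.rewardSum - ((c : ℝ) - (N / 2 : ℕ)) * mean ν a)
          + ((N : ℝ) - (c + 1 : ℕ)) * (2 * x ^ 2) - 4 * ((N : ℝ) - (N / 2 : ℕ)) * x ^ 2
          + 4 * x * κ * (p.1 - mean ν a)
        rw [h3]
        rw [show (c : ℝ) = N - 1 by linarith]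
        linarith
    refine (lintegral_mono hle).trans ?_
    rw [lintegral_add_left hmexp]
    refine add_le_add hexp ?_
    have hmset : MeasurableSet {z : ℝ | y < κ * z} :=
      measurableSet_lt measurable_const (measurable_const.mul measurable_id)
    have hmi : Measurable ({z : ℝ | y < κ * z}.indicator (fun _ => (1 : ENNReal))) :=
      measurable_const.indicator hmset
    rw [rewardNoise, measurePreserving_snd.lintegral_comp hmi, lintegral_indicator_const hmset,
      one_mul, ← ha, ← hc, h3]
    have hNr : (0 : ℝ) < N := by exact_mod_cast hNpos
    refine (laplace_tail (by positivity) hy hκ).trans (eexp_mono (le_of_eq ?_))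
    field_simp

/-- The confidence radius of the index at time `t` of an arm that has been played `N` times. -/
def radius (α ε : ℝ) (t N : ℕ) : ℝ :=
  Real.sqrt (α * Real.log t / (2 * (1 / 2 * (N : ℝ)))) +
    α * Real.log t / (ε * (1 / 2 * (N : ℝ)))

theorem index_eq (α ε : ℝ) (t : ℕ) (s : State K) (a : Fin K) :
    index α ε t s a = s.privMean a + radius α ε t (s.count a) := by
  rw [index, radius, add_assoc]

/-- Arm `a` has been played `N` times, and its private mean deviates from `μ` by more than `ρ` in the
direction `κ`. -/
def Deviates (a : Fin K) (μ κ ρ : ℝ) (N : ℕ) (s : State K) : Prop :=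
  s.count a = N ∧ ρ < κ * (s.privMean a - μ)

theorem MeasState.measurableSet_deviates {Ω : Type*} [MeasurableSpace Ω] {f : Ω → State K}
    (hf : MeasState f) (a : Fin K) (μ κ ρ : ℝ) (N : ℕ) :
    MeasurableSet {ω | Deviates a μ κ ρ N (f ω)} := by
  have hc : Measurable fun ω => (f ω).count a := (measurable_pi_apply a).comp hf.count
  have hp : Measurable fun ω => (f ω).privMean a := (measurable_pi_apply a).comp hf.privMean
  have hp' : Measurable fun ω => κ * ((f ω).privMean a - μ) := by fun_prop
  exact (measurableSet_eq_fun hc measurable_const).inter (measurableSet_lt measurable_const hp')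

/-- The potential dominates the indicator of the event after `n` rounds, so its initial value bounds
the probability. Taking `x` and `y` to be the two terms of the radius makes each of the two
exponentials at most `exp (-α * log (n + 1))`. The threshold is fixed by `n` and `j`, hence
deterministic throughout. -/
theorem measure_deviates_le [NeZero K] (σ : ArgmaxRule K) {α ε : ℝ} (hα : 0 < α) (hε : 0 < ε)
    {ν : Fin K → Measure ℝ} [∀ a, IsProbabilityMeasure (ν a)]
    (hν : ∀ a, ∀ᵐ x ∂(ν a), x ∈ Set.Icc (0 : ℝ) 1) {κ : ℝ} (hκ : κ = 1 ∨ κ = -1) (a : Fin K)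
    (j n : ℕ) :
    law σ α ε ν n {h | Deviates a (mean ν a) κ (radius α ε (n + 1) (2 ^ j)) (2 ^ j)
      (state σ α ε n h)} ≤
      ENNReal.ofReal (2 * ((n + 1 : ℕ) : ℝ) ^ (-α)) := by
  set L := α * Real.log ((n + 1 : ℕ) : ℝ) with hL
  have hL0 : 0 ≤ L := mul_nonneg hα.le (Real.log_natCast_nonneg _)
  set N := 2 ^ j with hN
  have hNr : (0 : ℝ) < (N : ℕ) := by rw [hN]; positivity
  set x := Real.sqrt (L / (2 * (1 / 2 * (N : ℝ)))) with hx
  set y := L / (ε * (1 / 2 * (N : ℝ))) with hy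
  have hx0 : 0 ≤ x := Real.sqrt_nonneg _
  have hy0 : 0 ≤ y := by positivity
  set F : State K → ENNReal := deviationPotential a N (mean ν a) κ x y ε with hF
  have hbound := lintegral_state_le σ α ε ν (F := F)
    (fun n => (measState_state σ α ε n).measurable_deviationPotential _ _ _ _ _ _ _)
    (fun n h => by
      have hr := reachable_state σ α ε n h
      refine (lintegral_deviationPotential_endRound_le (hr.ready σ α ε) hν hε a j hκ hx0 hy0).trans
        (le_of_eq (deviationPotential_beginRound hr σ α ε a j _ _ _ _))) n
  have hset := (measState_state σ α ε n).measurableSet_deviates a (mean ν a) κ (radius α ε (n + 1) N)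
    N
  calc _ = ∫⁻ h, {h | Deviates a (mean ν a) κ (radius α ε (n + 1) N) N
        (state σ α ε n h)}.indicator 1 h ∂(law σ α ε ν n) := (lintegral_indicator_one hset).symm
    _ ≤ ∫⁻ h, F (state σ α ε n h) ∂(law σ α ε ν n) := by
      refine lintegral_mono fun h => ?_
      by_cases hh : h ∈ {h | Deviates a (mean ν a) κ (radius α ε (n + 1) N) N (state σ α ε n h)}
      · have hlt : N / 2 < N := Nat.div_lt_self (by positivity) (by norm_num)
        rw [Set.indicator_of_mem hh, hF, deviationPotential, hh.1, if_neg (not_le.2 hlt),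
          if_neg (lt_irrefl _), if_pos rfl, if_pos (show x + y < _ from hh.2),
          Pi.one_apply]
      · rw [Set.indicator_of_notMem hh]
        exact zero_le
    _ ≤ F (initState K) := hbound
    _ ≤ ENNReal.ofReal (2 * ((n + 1 : ℕ) : ℝ) ^ (-α)) := by
      have hpow : Real.exp (-L) = ((n + 1 : ℕ) : ℝ) ^ (-α) := by
        rw [Real.rpow_def_of_pos (by positivity), hL]; congr 1; ring
      -- The mean uses at least `N / 2` rewards, which is why the radius contains half the count.
      have hm : (N : ℝ) ≤ 2 * ((N : ℝ) - (N / 2 : ℕ)) := by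
        have : 2 * (N / 2) ≤ N := by omega
        have : (2 : ℝ) * (N / 2 : ℕ) ≤ N := by exact_mod_cast this
        linarith
      have hxs : x ^ 2 = L / N := by
        rw [hx, Real.sq_sqrt (by positivity)]; congr 1; ring
      have h1 : L ≤ 2 * ((N : ℝ) - (N / 2 : ℕ)) * x ^ 2 := by
        calc L = N * x ^ 2 := by rw [hxs]; field_simp
          _ ≤ _ := by gcongr
      have h2 : y * (ε * N) / 2 = L := by rw [hy]; field_simp
      rw [hF, deviationPotential, if_pos (by simp [initState]), h2, ← hpow,
        two_mul (Real.exp _), ENNReal.ofReal_add (Real.exp_pos _).le (Real.exp_pos _).le]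
      exact add_le_add (eexp_mono (by linarith)) le_rfl

/-! ### The number of plays of an arm -/

/-- After `n` rounds the private mean of arm `a` is too large or that of arm `b` is too small. -/
def BadRound (α ε : ℝ) (ν : Fin K → Measure ℝ) (a b : Fin K) (n : ℕ) (s : State K) : Prop :=
  ∃ j ∈ Finset.range n, Deviates a (mean ν a) 1 (radius α ε (n + 1) (2 ^ j)) (2 ^ j) s ∨
    Deviates b (mean ν b) (-1) (radius α ε (n + 1) (2 ^ j)) (2 ^ j) s

open Classical in
/-- An upper bound on the total length of the episodes among the first `n` rounds that start in a
bad round. -/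
def badWeight [NeZero K] (σ : ArgmaxRule K) (α ε : ℝ) (ν : Fin K → Measure ℝ) (a b : Fin K) :
    (n : ℕ) → (Fin n → Round K) → ℝ
  | 0, _ => 0
  | n + 1, h => badWeight σ α ε ν a b n (Fin.init h) +
      if BadRound α ε ν a b n (state σ α ε n (Fin.init h)) then (n : ℝ) else 0

/-- Each term is at most `(i + 1) ^ (2 - α)`, whose sum is compared with the integral of `x ^ (2 -
α)` from 1, convergent for `α > 3`. -/
theorem sum_sq_mul_rpow_le {α : ℝ} (hα : 3 < α) (n : ℕ) :
    ∑ i ∈ Finset.range n, (i : ℝ) ^ 2 * ((i + 1 : ℕ) : ℝ) ^ (-α) ≤ 1 / (α - 3) := by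
  have h0 : 0 < 1 / (α - 3) := one_div_pos.2 (by linarith)
  rcases n with - | m
  · simpa using h0.le
  -- The term `i = 0` vanishes; removing it lets the integral start at 1 with no extra summand.
  rw [Finset.sum_range_succ']
  have hanti : AntitoneOn (fun x : ℝ => x ^ (2 - α)) (Set.Icc 1 (1 + (m : ℝ))) := by
    intro x hx y hy hxy
    exact Real.rpow_le_rpow_of_nonpos (by linarith [hx.1]) hxy (by linarith)
  have hint := hanti.sum_le_integral
  rw [integral_rpow (Or.inr ⟨by linarith, by
    rw [Set.uIcc_of_le (by linarith [Nat.cast_nonneg (α := ℝ) m])]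
    intro h; linarith [h.1]⟩)] at hint
  calc _ ≤ ∑ i ∈ Finset.range m, (1 + ((i + 1 : ℕ) : ℝ)) ^ (2 - α) := by
        simp only [Nat.cast_zero, ne_eq, OfNat.ofNat_ne_zero, not_false_eq_true, zero_pow, zero_mul,
          add_zero]
        refine Finset.sum_le_sum fun i _ => ?_
        rw [show (1 + ((i + 1 : ℕ) : ℝ)) = ((i + 1 + 1 : ℕ) : ℝ) by push_cast; ring,
          Real.rpow_sub (by positivity), Real.rpow_neg (by positivity), div_eq_mul_inv]
        gcongr
        rw [Real.rpow_two]
        gcongr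
        linarith
    _ ≤ _ := hint
    _ = (1 - (1 + (m : ℝ)) ^ (2 - α + 1)) / (α - 3) := by
        rw [Real.one_rpow, ← neg_div_neg_eq]; congr 1 <;> ring
    _ ≤ 1 / (α - 3) := by
        have : 0 ≤ (1 + (m : ℝ)) ^ (2 - α + 1) := by positivity
        gcongr
        linarith

/-! ### Expected weight of the bad rounds -/

section

variable [NeZero K] (σ : ArgmaxRule K) (α ε : ℝ) (ν : Fin K → Measure ℝ)

theorem setOf_badRound_eq (a b : Fin K) (n : ℕ) :
    {h | BadRound α ε ν a b n (state σ α ε n h)} = ⋃ j ∈ Finset.range n,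
      ({h | Deviates a (mean ν a) 1 (radius α ε (n + 1) (2 ^ j)) (2 ^ j) (state σ α ε n h)} ∪
      {h | Deviates b (mean ν b) (-1) (radius α ε (n + 1) (2 ^ j)) (2 ^ j) (state σ α ε n h)}) := by
  ext h
  simp [BadRound]

theorem measurableSet_badRound (a b : Fin K) (n : ℕ) :
    MeasurableSet {h | BadRound α ε ν a b n (state σ α ε n h)} := by
  have hms := measState_state σ α ε n
  rw [setOf_badRound_eq]
  exact Finset.measurableSet_biUnion _ fun j _ =>
    (hms.measurableSet_deviates _ _ _ _ _).union (hms.measurableSet_deviates _ _ _ _ _)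

/-- A union bound over `n` exponents and two arms, each event having probability at most `2 * (n +
1) ^ (-α)`. -/
theorem measure_badRound_le [∀ a, IsProbabilityMeasure (ν a)] (hα : 0 < α) (hε : 0 < ε)
    (hν : ∀ a, ∀ᵐ x ∂(ν a), x ∈ Set.Icc (0 : ℝ) 1) (a b : Fin K) (n : ℕ) :
    (law σ α ε ν n).real {h | BadRound α ε ν a b n (state σ α ε n h)} ≤
      4 * (n * ((n + 1 : ℕ) : ℝ) ^ (-α)) := by
  have hdev : ∀ (κ : ℝ), κ = 1 ∨ κ = -1 → ∀ (c : Fin K) (j : ℕ),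
      (law σ α ε ν n).real {h | Deviates c (mean ν c) κ (radius α ε (n + 1) (2 ^ j)) (2 ^ j)
        (state σ α ε n h)} ≤ 2 * ((n + 1 : ℕ) : ℝ) ^ (-α) := fun κ hκ c j =>
    ENNReal.toReal_le_of_le_ofReal (by positivity)
      (measure_deviates_le σ hα hε hν hκ c j n)
  rw [setOf_badRound_eq]
  refine (measureReal_biUnion_finset_le _ _).trans ?_
  calc _ ≤ ∑ j ∈ Finset.range n, 4 * ((n + 1 : ℕ) : ℝ) ^ (-α) := by
        refine Finset.sum_le_sum fun j _ => (measureReal_union_le _ _).trans ?_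
        linarith [hdev 1 (Or.inl rfl) a j, hdev (-1) (Or.inr rfl) b j]
    _ = _ := by rw [Finset.sum_const, Finset.card_range, nsmul_eq_mul]; ring

theorem badWeight_nonneg (a b : Fin K) (n : ℕ) (h : Fin n → Round K) :
    0 ≤ badWeight σ α ε ν a b n h := by
  induction n with
  | zero => exact le_rfl
  | succ n ih =>
    rw [badWeight]
    have := ih (Fin.init h)
    positivity

theorem integrable_badWeight [∀ a, IsProbabilityMeasure (ν a)] (a b : Fin K) (n : ℕ) :
    Integrable (badWeight σ α ε ν a b n) (law σ α ε ν n) ∧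
    ∫ h, badWeight σ α ε ν a b n h ∂(law σ α ε ν n) =
      ∑ i ∈ Finset.range n,
        i * (law σ α ε ν i).real {h | BadRound α ε ν a b i (state σ α ε i h)} := by
  classical
  induction n with
  | zero =>
    have h0 : badWeight σ α ε ν a b 0 = fun _ => 0 := rfl
    simp [h0]
  | succ n ih =>
    obtain ⟨ihi, ihe⟩ := ih
    set D := {h | BadRound α ε ν a b n (state σ α ε n h)} with hD
    have hDm : MeasurableSet D := measurableSet_badRound σ α ε ν a b n
    set g : (Fin n → Round K) → ℝ := fun h =>
      badWeight σ α ε ν a b n h + D.indicator (fun _ => (n : ℝ)) h with hg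
    have hgi : Integrable g (law σ α ε ν n) :=
      ihi.add ((integrable_const _).indicator hDm)
    have hfun : badWeight σ α ε ν a b (n + 1) =
        g ∘ fun h : Fin (n + 1) → Round K => (Fin.init h : Fin n → Round K) := by
      funext h
      simp only [badWeight, hg, Function.comp_apply, Set.indicator, hD]
      rfl
    have hge : ∫ h, g h ∂(law σ α ε ν n) = ∑ i ∈ Finset.range (n + 1),
        i * (law σ α ε ν i).real {h | BadRound α ε ν a b i (state σ α ε i h)} := by
      rw [hg, integral_add ihi ((integrable_const _).indicator hDm), ihe,
        integral_indicator_const _ hDm, Finset.sum_range_succ, smul_eq_mul, mul_comm]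
    rw [← law_map_init σ α ε ν n] at hgi
    constructor
    · rw [hfun]
      exact hgi.comp_measurable measurable_init_round
    · rw [hfun, ← hge]
      conv_rhs => rw [← law_map_init σ α ε ν n]
      exact (integral_map measurable_init_round.aemeasurable hgi.aestronglyMeasurable).symm

theorem integral_badWeight_le [∀ a, IsProbabilityMeasure (ν a)] (hα : 3 < α) (hε : 0 < ε)
    (hν : ∀ a, ∀ᵐ x ∂(ν a), x ∈ Set.Icc (0 : ℝ) 1) (a b : Fin K) (n : ℕ) :
    ∫ h, badWeight σ α ε ν a b n h ∂(law σ α ε ν n) ≤ 4 / (α - 3) := by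
  rw [(integrable_badWeight σ α ε ν a b n).2]
  calc _ ≤ ∑ i ∈ Finset.range n, 4 * ((i : ℝ) ^ 2 * ((i + 1 : ℕ) : ℝ) ^ (-α)) := by
        refine Finset.sum_le_sum fun i _ => ?_
        calc _ ≤ (i : ℝ) * (4 * (i * ((i + 1 : ℕ) : ℝ) ^ (-α))) := by
              gcongr
              exact measure_badRound_le σ α ε ν (by linarith) hε hν a b i
          _ = _ := by ring
    _ ≤ 4 * (1 / (α - 3)) := by
        rw [← Finset.mul_sum]
        gcongr
        exact sum_sq_mul_rpow_le hα n
    _ = _ := by ring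

end

/-! ### Pathwise bound on gap times number of plays -/

theorem natCast_mul_radius {α ε : ℝ} (hε : 0 < ε) (t : ℕ) {N : ℕ} (hN : 0 < N) :
    (N : ℝ) * radius α ε t N = Real.sqrt (α * N * Real.log t) + 2 * α * Real.log t / ε := by
  have hN' : (0 : ℝ) < N := by exact_mod_cast hN
  rw [radius, mul_add]
  congr 1
  · nth_rewrite 1 [← Real.sqrt_sq hN'.le]
    rw [← Real.sqrt_mul (by positivity)]
    congr 1
    field_simp
  · field_simp

theorem gap_nonneg (ν : Fin K → Measure ℝ) (a : Fin K) : 0 ≤ gap ν a :=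
  sub_nonneg.2 (le_ciSup (Set.finite_range (mean ν)).bddAbove a)

/-- The UCB chain: `μ^*` is at most the index of the best arm `b`, hence at most that of `a`, hence
at most `mean ν a` plus two radii. -/
theorem gap_le_two_mul_radius {α ε : ℝ} {ν : Fin K → Measure ℝ} {a b : Fin K}
    (hb : mean ν b = bestMean ν) {n : ℕ} {s : State K}
    (hs : ∀ c, ∃ j ∈ Finset.range n, s.count c = 2 ^ j)
    (hbad : ¬ BadRound α ε ν a b n s) (hle : index α ε (n + 1) s b ≤ index α ε (n + 1) s a) :
    gap ν a ≤ 2 * radius α ε (n + 1) (s.count a) := by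
  obtain ⟨i, hi, hia⟩ := hs a
  obtain ⟨j, hj, hjb⟩ := hs b
  have ha : s.privMean a - mean ν a ≤ radius α ε (n + 1) (s.count a) := by
    by_contra! h
    exact hbad ⟨i, hi, Or.inl ⟨hia, by rw [← hia]; linarith⟩⟩
  have hb' : -(s.privMean b - mean ν b) ≤ radius α ε (n + 1) (s.count b) := by
    by_contra! h
    exact hbad ⟨j, hj, Or.inr ⟨hjb, by rw [← hjb]; linarith⟩⟩
  rw [index_eq, index_eq] at hle
  rw [gap, ← hb]
  linarith

/-- The number of plays of arm `a` at the end of the current episode. -/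
def committed (a : Fin K) (s : State K) : ℕ := if a = s.arm then s.goal else s.count a

theorem Reachable.count_le_committed {n : ℕ} {s : State K} (hs : Reachable n s) (a : Fin K) :
    s.count a ≤ committed a s := by
  by_cases hn : n = 0
  · have := hs.count_of_le (by omega) a
    simp [this, hn]
  · obtain ⟨i, -, -, -, hle⟩ := hs.episode hn
    rw [committed]
    split_ifs with harm
    · rwa [harm]
    · exact le_rfl

/-- Tracking the count at the end of the episode makes the induction work, since it rises only when
an episode starts. A good start from count `N` gives `gap * 2 * N ≤ 4 * N * radius`. A bad start
adds at most `N ≤ n` plays, which `badWeight` pays for. The square root keeps the actual count, so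
that summing over arms later gives `T` exactly. -/
theorem gap_mul_committed_le [NeZero K] (σ : ArgmaxRule K) {α ε : ℝ} (hα : 0 < α) (hε : 0 < ε)
    {ν : Fin K → Measure ℝ} {a b : Fin K} (hb : mean ν b = bestMean ν) {T n : ℕ} (hn : n ≤ T)
    (h : Fin n → Round K) :
    gap ν a * committed a (state σ α ε n h) ≤ gap ν a * (1 + badWeight σ α ε ν a b n h) +
      4 * Real.sqrt (α * (state σ α ε n h).count a * Real.log T) + 8 * α * Real.log T / ε := by
  classical
  have hgap := gap_nonneg ν a
  have hT : 0 ≤ Real.log T := Real.log_natCast_nonneg T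
  have hrest : 0 ≤ 8 * α * Real.log T / ε := by positivity
  induction n with
  | zero =>
    have : committed a (state σ α ε 0 h) = 0 := by
      unfold committed
      split_ifs <;> rfl
    rw [this]
    have := badWeight_nonneg σ α ε ν a b 0 h
    simp only [Nat.cast_zero, mul_zero]
    positivity
  | succ n ih =>
    specialize ih (by omega) (Fin.init h)
    have hr := reachable_state σ α ε n (Fin.init h)
    have hW := badWeight_nonneg σ α ε ν a b n (Fin.init h)
    have hcle : ∀ c, (state σ α ε n (Fin.init h)).count c ≤ n :=
      count_state_le σ α ε n (Fin.init h)
    have hcount : (state σ α ε n (Fin.init h)).count a ≤ (state σ α ε (n + 1) h).count a := by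
      rw [state, count_endRound, beginRound_count]; omega
    have hcomm : committed a (state σ α ε (n + 1) h) =
        committed a (beginRound σ α ε n (state σ α ε n (Fin.init h))) := by
      simp only [committed, state, endRound_arm, endRound_goal, count_endRound]
      split_ifs <;> rfl
    rw [hcomm, badWeight]
    generalize badWeight σ α ε ν a b n (Fin.init h) = W at *
    generalize (state σ α ε (n + 1) h).count a = c' at *
    generalize state σ α ε n (Fin.init h) = s at *
    have hmono : 4 * Real.sqrt (α * s.count a * Real.log T) ≤
        4 * Real.sqrt (α * c' * Real.log T) := by
      have : (s.count a : ℝ) ≤ c' := by exact_mod_cast hcount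
      gcongr
    refine le_trans ?_ (add_le_add_left (add_le_add_right hmono _) _)
    have hsq : 0 ≤ 4 * Real.sqrt (α * s.count a * Real.log T) := by positivity
    have hind : 0 ≤ (if BadRound α ε ν a b n s then (n : ℝ) else 0) := by positivity
    have hcc : (s.count a : ℝ) ≤ committed a s := by exact_mod_cast hr.count_le_committed a
    -- This settles the rounds of other arms: the committed value is then the count, which never
    -- exceeds the previous committed value.
    have hold : gap ν a * s.count a ≤ gap ν a * (1 + (W + if BadRound α ε ν a b n s then (n : ℝ)
        else 0)) + 4 * Real.sqrt (α * s.count a * Real.log T) + 8 * α * Real.log T / ε := by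
      have h1 := mul_le_mul_of_nonneg_left hcc hgap
      have h2 := mul_nonneg hgap hind
      linarith
    by_cases harm : a = (beginRound σ α ε n s).arm
    swap
    · rw [committed, if_neg harm, beginRound_count]
      exact hold
    rw [committed, if_pos harm]
    by_cases hK : n < K
    -- The initial play of the arm is paid for by the summand 1.
    · have : (beginRound σ α ε n s).goal = 1 := by simp [beginRound, hK]
      rw [this, Nat.cast_one]
      have := mul_nonneg hgap hind
      have := mul_nonneg hgap hW
      linarith
    by_cases hg : s.count s.arm < s.goal
    · have hbr : beginRound σ α ε n s = s := by simp [beginRound, hK, hg]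
      rw [hbr] at harm ⊢
      rw [committed, if_pos harm] at ih
      have := mul_nonneg hgap hind
      linarith
    have hn0 : n ≠ 0 := by have := NeZero.ne K; omega
    have hsel : a = σ.select (index α ε (n + 1) s) := by simpa [beginRound, hK, hg] using harm
    have hgoal : (beginRound σ α ε n s).goal = 2 * s.count a := by
      rw [hsel]; simp [beginRound, hK, hg]
    rw [hgoal]
    push_cast
    by_cases hbad : BadRound α ε ν a b n s
    · rw [if_pos hbad]
      have h1 : gap ν a * s.count a ≤ gap ν a * n := by gcongr; exact hcle a
      have h2 := mul_le_mul_of_nonneg_left hcc hgap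
      linarith
    · rw [if_neg hbad, add_zero]
      -- From `j < 2 ^ j = count ≤ n`, the exponents fall in the range covered by `BadRound`.
      have hdy : ∀ c, ∃ j ∈ Finset.range n, s.count c = 2 ^ j := by
        intro c
        have hpos := hr.one_le_count (not_lt.1 hK) c
        rcases hr.dyadic_of_goal_le hn0 (not_lt.1 hg) c with h0 | ⟨j, hj⟩
        · omega
        · refine ⟨j, Finset.mem_range.2 ?_, hj⟩
          have h1 : j < 2 ^ j := Nat.lt_two_pow_self
          have h2 := hcle c
          omega
      have hkey := gap_le_two_mul_radius hb hdy hbad (by rw [hsel]; exact σ.le_select _ b)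
      have hNpos : 0 < s.count a := hr.one_le_count (not_lt.1 hK) a
      have h1 := mul_le_mul_of_nonneg_left hkey (Nat.cast_nonneg (α := ℝ) (s.count a))
      have h2 := natCast_mul_radius (α := α) hε (n + 1) hNpos
      have hlog : Real.log ((n + 1 : ℕ) : ℝ) ≤ Real.log T :=
        Real.log_le_log (by positivity) (by exact_mod_cast hn)
      have h3 : Real.sqrt (α * s.count a * Real.log ((n + 1 : ℕ) : ℝ)) ≤
          Real.sqrt (α * s.count a * Real.log T) := by gcongr
      have h4 : 2 * α * Real.log ((n + 1 : ℕ) : ℝ) / ε ≤ 2 * α * Real.log T / ε := by gcongr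
      have h5 : 8 * α * Real.log T / ε = 4 * (2 * α * Real.log T / ε) := by ring
      have h6 : 0 ≤ gap ν a * (1 + W) := by positivity
      rw [h5]
      linarith

theorem gap_mul_count_le [NeZero K] (σ : ArgmaxRule K) {α ε : ℝ} (hα : 0 < α) (hε : 0 < ε)
    {ν : Fin K → Measure ℝ} {a b : Fin K} (hb : mean ν b = bestMean ν) (T : ℕ)
    (h : Fin T → Round K) :
    gap ν a * (state σ α ε T h).count a ≤ gap ν a * (1 + badWeight σ α ε ν a b T h) +
      4 * Real.sqrt (α * (state σ α ε T h).count a * Real.log T) + 8 * α * Real.log T / ε := by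
  refine le_trans ?_ (gap_mul_committed_le σ hα hε hb le_rfl h)
  refine mul_le_mul_of_nonneg_left ?_ (gap_nonneg ν a)
  exact_mod_cast (reachable_state σ α ε T h).count_le_committed a

/-! ### The regret bound -/

theorem regret_eq [NeZero K] (σ : ArgmaxRule K) (α ε : ℝ) (ν : Fin K → Measure ℝ)
    [∀ a, IsProbabilityMeasure (ν a)] (hν : ∀ a, ∀ᵐ x ∂(ν a), x ∈ Set.Icc (0 : ℝ) 1) (T : ℕ) :
    regret σ α ε ν T = ∫ h, ∑ a, gap ν a * ((state σ α ε T h).count a : ℝ) ∂(law σ α ε ν T) := by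
  have hT : (T : ℝ) * bestMean ν =
      ∫ h, ∑ a, bestMean ν * ((state σ α ε T h).count a : ℝ) ∂(law σ α ε ν T) := by
    have : ∀ h, ∑ a, bestMean ν * ((state σ α ε T h).count a : ℝ) = T * bestMean ν := by
      intro h
      rw [← Finset.mul_sum, ← Nat.cast_sum, sum_count_state, mul_comm]
    simp [this]
  rw [regret, integral_sum_reward σ α ε ν hν, hT, ← integral_sub]
  · simp only [gap, sub_mul, Finset.sum_sub_distrib]
  all_goals exact integrable_finsetSum _ fun a _ => (integrable_count σ α ε ν T a).const_mul _

/-- Cauchy–Schwarz over the `K` arms, with counts summing to `T`. -/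
theorem sum_sqrt_count_le [NeZero K] (σ : ArgmaxRule K) (α ε : ℝ) (hα : 0 < α) (T : ℕ)
    (h : Fin T → Round K) :
    ∑ a, Real.sqrt (α * (state σ α ε T h).count a * Real.log T) ≤
      Real.sqrt (α * K * T * Real.log T) := by
  have hT : 0 ≤ Real.log T := Real.log_natCast_nonneg T
  refine Real.le_sqrt_of_sq_le ((sq_sum_le_card_mul_sum_sq).trans (le_of_eq ?_))
  have : ∀ a, Real.sqrt (α * (state σ α ε T h).count a * Real.log T) ^ 2 =
      α * (state σ α ε T h).count a * Real.log T := fun a => Real.sq_sqrt (by positivity)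
  simp only [this]
  rw [← Finset.sum_mul, ← Finset.mul_sum, ← Nat.cast_sum, sum_count_state]
  simp
  ring

/-- The argument gives the last two terms with half the constants of the final statement. -/
theorem regret_le [NeZero K] (σ : ArgmaxRule K) {α ε : ℝ} (hα : 3 < α) (hε : 0 < ε)
    {ν : Fin K → Measure ℝ} [∀ a, IsProbabilityMeasure (ν a)]
    (hν : ∀ a, ∀ᵐ x ∂(ν a), x ∈ Set.Icc (0 : ℝ) 1) (T : ℕ) :
    regret σ α ε ν T ≤ (1 + 4 / (α - 3)) * ∑ a, gap ν a +
      4 * Real.sqrt (α * K * T * Real.log T) + 8 * α * K * Real.log T / ε := by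
  have hα0 : 0 < α := by linarith
  obtain ⟨b, hb⟩ := exists_eq_ciSup_of_finite (f := mean ν)
  have hint : ∀ a, Integrable (fun h => gap ν a * (1 + badWeight σ α ε ν a b T h))
      (law σ α ε ν T) := fun a =>
    ((integrable_const _).add (integrable_badWeight σ α ε ν a b T).1).const_mul _
  have hpt : ∀ h, ∑ a, gap ν a * ((state σ α ε T h).count a : ℝ) ≤
      ∑ a, gap ν a * (1 + badWeight σ α ε ν a b T h) +
      (4 * Real.sqrt (α * K * T * Real.log T) + 8 * α * K * Real.log T / ε) := by
    intro h
    refine (Finset.sum_le_sum fun a _ => gap_mul_count_le σ hα0 hε hb T h).trans ?_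
    rw [Finset.sum_add_distrib, Finset.sum_add_distrib, ← Finset.mul_sum, Finset.sum_const,
      Finset.card_univ, Fintype.card_fin, nsmul_eq_mul, add_assoc]
    have h1 := sum_sqrt_count_le σ α ε hα0 T h
    have h2 : (K : ℝ) * (8 * α * Real.log T / ε) = 8 * α * K * Real.log T / ε := by ring
    rw [h2]
    linarith
  rw [regret_eq σ α ε ν hν, add_assoc]
  refine (integral_mono
    (integrable_finsetSum _ fun a _ => (integrable_count σ α ε ν T a).const_mul _)
    ((integrable_finsetSum _ fun a _ => hint a).add (integrable_const _)) hpt).trans ?_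
  rw [integral_add' (integrable_finsetSum _ fun a _ => hint a) (integrable_const _),
    integral_finsetSum _ fun a _ => hint a, integral_const, probReal_univ, one_smul]
  refine add_le_add ?_ le_rfl
  rw [Finset.mul_sum]
  refine Finset.sum_le_sum fun a _ => ?_
  rw [integral_const_mul, integral_add (integrable_const _) (integrable_badWeight σ α ε ν a b T).1,
    integral_const, probReal_univ, one_smul, mul_comm]
  refine mul_le_mul_of_nonneg_right ?_ (gap_nonneg ν a)
  linarith [integral_badWeight_le σ α ε ν hα hε hν a b T]

/-! ### Comparison with the minimax lower bound -/

theorem mean_mem_Icc {ν : Fin K → Measure ℝ} [∀ a, IsProbabilityMeasure (ν a)]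
    (hν : ∀ a, ∀ᵐ x ∂(ν a), x ∈ Set.Icc (0 : ℝ) 1) (a : Fin K) :
    mean ν a ∈ Set.Icc (0 : ℝ) 1 := by
  have hi : Integrable (fun x : ℝ => x) (ν a) := Integrable.of_mem_Icc 0 1 aemeasurable_id' (hν a)
  constructor
  · exact integral_nonneg_of_ae ((hν a).mono fun x hx => hx.1)
  · have := integral_mono_ae hi (integrable_const (1 : ℝ)) ((hν a).mono fun x hx => hx.2)
    simpa [mean] using this

/-- A best arm contributes nothing and every other arm at most 1; this yields `K - 1`, the quantity
in the lower bound. -/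
theorem sum_gap_le [NeZero K] {ν : Fin K → Measure ℝ} [∀ a, IsProbabilityMeasure (ν a)]
    (hν : ∀ a, ∀ᵐ x ∂(ν a), x ∈ Set.Icc (0 : ℝ) 1) : ∑ a, gap ν a ≤ (K : ℝ) - 1 := by
  obtain ⟨b, hb⟩ := exists_eq_ciSup_of_finite (f := mean ν)
  have hgb : gap ν b = 0 := sub_eq_zero.2 hb.symm
  have hg : ∀ a, gap ν a ≤ 1 := by
    intro a
    have h1 := (mean_mem_Icc hν a).1
    have h2 := (mean_mem_Icc hν b).2
    rw [gap, bestMean, ← hb]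
    linarith
  rw [← Finset.add_sum_erase _ _ (Finset.mem_univ b), hgb, zero_add]
  refine (Finset.sum_le_card_nsmul _ _ 1 fun a _ => hg a).trans (le_of_eq ?_)
  rw [Finset.card_erase_of_mem (Finset.mem_univ b), Finset.card_univ, Fintype.card_fin,
    nsmul_eq_mul, mul_one, Nat.cast_sub (NeZero.one_le), Nat.cast_one]

theorem regretBound_le_minimaxLowerBound {α ε : ℝ} (hα : 3 < α) (hε : 0 < ε) {T : ℕ} (hK : 2 ≤ K)
    (hT : 2 ≤ T) (hKT : K - 1 ≤ T) {G : ℝ} (hG : G ≤ (K : ℝ) - 1) :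
    3 * α / (α - 3) * G + 8 * Real.sqrt (α * K * T * Real.log T)
        + 16 * α * K * Real.log T / ε ≤
      (27 * (3 * α / (α - 3)) * 2 + 27 * 8 * (2 * Real.sqrt (2 * α)) + 131 * (32 * α)) *
        Real.log T * minimaxLowerBound K T ε := by
  set M := minimaxLowerBound K T ε with hM
  set R := Real.sqrt (T * ((K : ℝ) - 1)) with hR
  have hK' : (2 : ℝ) ≤ K := by exact_mod_cast hK
  have hT' : (2 : ℝ) ≤ T := by exact_mod_cast hT
  have hKT' : (K : ℝ) - 1 ≤ T := by
    have : K ≤ T + 1 := by omega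
    have : (K : ℝ) ≤ T + 1 := by exact_mod_cast this
    linarith
  -- This lets `2 * log T ≥ 1` absorb the terms with too small a power of the logarithm.
  have hlog : 1 / 2 ≤ Real.log T := by
    have h2 := Real.log_two_gt_d9
    have h3 := Real.log_le_log (by norm_num) hT'
    linarith
  have hM1 : R ≤ 27 * M := by
    have : 1 / 27 * R ≤ M := le_max_left _ _
    linarith
  have hM2 : ((K : ℝ) - 1) / ε ≤ 131 * M := by
    have : 1 / 131 * (((K : ℝ) - 1) / ε) ≤ M := le_max_right _ _
    linarith
  have hR0 : 0 ≤ R := Real.sqrt_nonneg _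
  have hM0 : 0 ≤ M := by linarith
  have hcoef : 0 ≤ 3 * α / (α - 3) := div_nonneg (by linarith) (by linarith)
  -- Here `K - 1 ≤ T` enters: `(K - 1) ^ 2 ≤ T * (K - 1)`.
  have hGR : G ≤ R := by
    refine hG.trans (Real.le_sqrt_of_sq_le ?_)
    rw [sq]
    exact mul_le_mul_of_nonneg_right hKT' (by linarith)
  have hlogM : M ≤ 2 * Real.log T * M := le_mul_of_one_le_left hM0 (by linarith)
  have t1 : 3 * α / (α - 3) * G ≤ 27 * (3 * α / (α - 3)) * 2 * Real.log T * M := by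
    calc 3 * α / (α - 3) * G ≤ 3 * α / (α - 3) * (27 * (2 * Real.log T * M)) := by
          gcongr; linarith
      _ = _ := by ring
  have t2 : 8 * Real.sqrt (α * K * T * Real.log T) ≤
      27 * 8 * (2 * Real.sqrt (2 * α)) * Real.log T * M := by
    have hle : Real.sqrt (α * K * T * Real.log T) ≤
        Real.sqrt (2 * α) * R * (2 * Real.log T) := by
      rw [hR, ← Real.sqrt_mul (by linarith)]
      refine Real.sqrt_le_iff.2 ⟨by positivity, ?_⟩
      rw [mul_pow, Real.sq_sqrt (by
        refine mul_nonneg (by linarith) (mul_nonneg (by linarith) (by linarith)))]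
      have hl2 : Real.log T ≤ (2 * Real.log T) ^ 2 := by nlinarith
      -- Since `K ≥ 2`, `K ≤ 2 * (K - 1)`.
      have hk : α * K * T ≤ 2 * α * (T * ((K : ℝ) - 1)) := by
        have : 0 ≤ α * T := mul_nonneg (by linarith) (by linarith)
        nlinarith
      exact mul_le_mul hk hl2 (by linarith)
        (mul_nonneg (by linarith) (mul_nonneg (by linarith) (by linarith)))
    calc _ ≤ 8 * (Real.sqrt (2 * α) * R * (2 * Real.log T)) := by gcongr
      _ ≤ 8 * (Real.sqrt (2 * α) * (27 * M) * (2 * Real.log T)) := by gcongr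
      _ = _ := by ring
  have t3 : 16 * α * K * Real.log T / ε ≤ 131 * (32 * α) * Real.log T * M := by
    calc _ ≤ 16 * α * (2 * ((K : ℝ) - 1)) * Real.log T / ε := by
          gcongr
          linarith
      _ = 32 * α * Real.log T * (((K : ℝ) - 1) / ε) := by ring
      _ ≤ 32 * α * Real.log T * (131 * M) := by gcongr
      _ = _ := by ring
  linarith

end AdaP

end

/-! ### The main theorem -/

theorem mainTheorem11 (α : ℝ) (hα : 3 < α) :
    (∀ (K : ℕ) [NeZero K] (σ : AdaP.ArgmaxRule K) (ε : ℝ) (_ : 0 < ε)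
        (ν : Fin K → MeasureTheory.Measure ℝ) [∀ a, MeasureTheory.IsProbabilityMeasure (ν a)]
        (_ : ∀ a, ∀ᵐ x ∂(ν a), x ∈ Set.Icc (0 : ℝ) 1) (T : ℕ),
        AdaP.regret σ α ε ν T ≤
          3 * α / (α - 3) * ∑ a, AdaP.gap ν a
            + 8 * Real.sqrt (α * K * T * Real.log T)
            + 16 * α * K * Real.log T / ε) ∧
    (∃ C : ℝ, 0 < C ∧
      ∀ (K : ℕ) (_ : 2 ≤ K) (ε : ℝ) (_ : 0 < ε)
        (ν : Fin K → MeasureTheory.Measure ℝ) [∀ a, MeasureTheory.IsProbabilityMeasure (ν a)]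
        (_ : ∀ a, ∀ᵐ x ∂(ν a), x ∈ Set.Icc (0 : ℝ) 1) (T : ℕ) (_ : 2 ≤ T) (_ : K - 1 ≤ T),
        3 * α / (α - 3) * ∑ a, AdaP.gap ν a
            + 8 * Real.sqrt (α * K * T * Real.log T)
            + 16 * α * K * Real.log T / ε ≤
          C * Real.log T * AdaP.minimaxLowerBound K T ε) := by
  have hα3 : 0 < α - 3 := by linarith
  constructor
  · intro K _ σ ε hε ν _ hν T
    refine (AdaP.regret_le σ hα hε hν T).trans ?_
    -- The left side is `(α + 1) / (α - 3)`.
    have hcoef : 1 + 4 / (α - 3) ≤ 3 * α / (α - 3) := by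
      rw [← sub_nonneg, show 3 * α / (α - 3) - (1 + 4 / (α - 3)) = (2 * α - 1) / (α - 3) by
        field_simp; ring]
      exact div_nonneg (by linarith) hα3.le
    have hlog : 0 ≤ Real.log T := Real.log_natCast_nonneg T
    refine add_le_add (add_le_add ?_ ?_) ?_
    · exact mul_le_mul_of_nonneg_right hcoef (Finset.sum_nonneg fun a _ => AdaP.gap_nonneg ν a)
    · linarith [Real.sqrt_nonneg (α * K * T * Real.log T)]
    · gcongr
      norm_num
  -- One summand for each of the three terms of the bound; 27 and 131 undo the constants of the
  -- lower bound.
  · refine ⟨27 * (3 * α / (α - 3)) * 2 + 27 * 8 * (2 * Real.sqrt (2 * α)) + 131 * (32 * α), ?_, ?_⟩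
    · positivity
    · intro K hK ε hε ν _ hν T hT hKT
      have : NeZero K := ⟨by omega⟩
      exact AdaP.regretBound_le_minimaxLowerBound hα hε hK hT hKT (AdaP.sum_gap_le hν)
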